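/- Let $q\in\mathbb C$ with $0<|q|<1$, and for $k=0,1,2,\dots$ write $(x)_k=\prod_{j=0}^{k-1}(1-xq^j)$ and $(x_1,\dots,x_m)_k=(x_1)_k\cdots(x_m)_k$. Let $r\ge 1$, let $n_1,\dots,n_r$ be nonnegative integers, and let $a,b$ and $c_i,d_i,e_i$ ($1\le i\le r$) be complex numbers with $a\ne 0$ and $$bc_id_ie_i=a^2q^{2-r+n_i}\qquad(i=1,\dots,r).$$ Assume that no denominator below vanishes, i.e. that $a\neq 1$ and that, for $i=1,\dots,r$, the numbers $(aq/b,\,aq/c_i,\,aq/d_i,\,aq/e_i,\,aq^{1+n_i},\,aq/c_id_ie_i)_{n_i}$, $(aq^{2+r-2i}/b)_{i-1}$ and $(aq^{2-r}/bc_i,\,aq^{2-r}/bd_i,\,aq^{2-r}/be_i,\,aq^{2-r+n_i}/b)_{r-1}$ are all nonzero. Then $$\begin{aligned} &\sum_{\substack{0\le k_i\le n_i\\ i=1,\dots,r}}\; \prod_{1\le i<j\le r}(q^{k_i}-q^{k_j})(1-aq^{k_i+k_j}) \prod_{i=1}^r\frac{(1-aq^{2k_i})\,(a,b,c_i,d_i,e_i,q^{-n_i})_{k_i}}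 {(1-a)\,(q,aq/b,aq/c_i,aq/d_i,aq/e_i,aq^{1+n_i})_{k_i}}\,q^{k_i}\\ &\quad=(-b)^{-\binom r2}q^{-2\binom r3} \prod_{i=1}^r\left(\frac{(aq^{2-r}/b)_{r-1}\,(b)_{i-1}}{(aq^{2+r-2i}/b)_{i-1}}\cdot \frac{(aq,\,aq/c_id_i,\,aq/c_ie_i,\,aq/d_ie_i)_{n_i}} {(aq/c_i,\,aq/d_i,\,aq/e_i,\,aq/c_id_ie_i)_{n_i}}\right)\\ &\qquad\times\det_{1\le i,j\le r}\left( \frac{(c_i,\,d_i,\,e_i,\,q^{-n_i})_{r-j}} {(aq^{2-r}/bc_i,\,aq^{2-r}/bd_i,\,aq^{2-r}/be_i,\,aq^{2-r+n_i}/b)_{r-j}}\right). \end{aligned}$$ Here $x/yz$ means $x/(yz)$. -/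

import Mathlib

/-- The `q`-shifted factorial `(a; q)_k = ∏_{0 ≤ j < k} (1 - a q^j)` for a natural number `k`. -/
noncomputable def qShifted (q a : ℂ) (k : ℕ) : ℂ :=
  ∏ j ∈ Finset.range k, (1 - a * q ^ j)

/-- The condensed notation `(a₁, …, a_m; q)_k = (a₁; q)_k ⋯ (a_m; q)_k`. -/
noncomputable def qShiftedList (q : ℂ) (l : List ℂ) (k : ℕ) : ℂ :=
  (l.map fun a => qShifted q a k).prod

/-! Put `x(k) = q⁻ᵏ + a qᵏ`. Since `qᵏ⁺ˡ (x(l) - x(k)) = (qᵏ - qˡ)(1 - a qᵏ⁺ˡ)`, the double product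
in the summand is, up to powers of `q`, a Vandermonde determinant in the `x(k_i)`. Its monomial
columns can be replaced, at the cost of a constant `K`, by products of `r - 1` linear factors: in
column `j` (from zero), `j` factors vanish at nodes `b qˡ + a/(b qˡ)` and `m = r - 1 - j` at nodes
`x(l)` (`det_prod_sub_mul_prod_sub`, `det_shiftFactor`).

By multilinearity in the rows the multiple sum becomes a determinant of single sums
(`sum_piFinset_prod_mul_det`). The nodes are chosen so that these factors merge with the `q`-shifted
factorials of the summand. Terms with `k < m` vanish, and after `k → m + k` what remains is
Jackson's `₈φ₇` with parameters `a q²ᵐ, b qʳ⁻¹, c qᵐ, d qᵐ, e qᵐ` and length `n - m`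
(`wellPoisedTerm_mul_shiftFactor`). The balancing hypothesis is exactly what Jackson's sum needs,
for every column at once. Its value factors into a part depending on the row, a part depending on
the column, and the entry of the final determinant.

Jackson's sum itself follows by induction on `n` from an explicit telescoping certificate
(`sum_jacksonTerm`). Two degenerate situations are treated apart: nongeneric `a`, by continuity, and
`(b)_{r-1} = 0`, where `K` may vanish, by showing that both sides are zero. -/

section

open Finset Filter Topology

/-! ### Elementary rules for `q`-shifted factorials. -/

section QShifted

variable (q : ℂ)

@[simp] theorem qShifted_zero (x : ℂ) : qShifted q x 0 = 1 := by simp [qShifted]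

theorem qShifted_succ (x : ℂ) (k : ℕ) :
    qShifted q x (k + 1) = qShifted q x k * (1 - x * q ^ k) := by
  simp [qShifted, prod_range_succ]

theorem qShifted_add (x : ℂ) (m k : ℕ) :
    qShifted q x (m + k) = qShifted q x m * qShifted q (x * q ^ m) k := by
  simp only [qShifted, prod_range_add]
  congr 1
  exact prod_congr rfl fun j _ => by ring

theorem qShifted_succ' (x : ℂ) (k : ℕ) :
    qShifted q x (k + 1) = (1 - x) * qShifted q (x * q) k := by
  rw [add_comm, qShifted_add, pow_one]; simp [qShifted]

theorem qShifted_ne_zero_iff (x : ℂ) (k : ℕ) :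
    qShifted q x k ≠ 0 ↔ ∀ j < k, 1 - x * q ^ j ≠ 0 := by
  simp [qShifted, prod_ne_zero_iff]

theorem qShifted_ne_zero_of_le {x : ℂ} {k l : ℕ} (h : qShifted q x l ≠ 0) (hkl : k ≤ l) :
    qShifted q x k ≠ 0 := by
  rw [qShifted_ne_zero_iff] at h ⊢
  exact fun j hj => h j (hj.trans_le hkl)

theorem qShifted_inv_pow_eq_zero (hq : q ≠ 0) {n k : ℕ} (h : n < k) :
    qShifted q (q ^ n)⁻¹ k = 0 := by
  refine prod_eq_zero (mem_range.2 h) ?_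
  rw [inv_mul_cancel₀ (pow_ne_zero _ hq), sub_self]

end QShifted

/-! ### Jackson's terminating `₈φ₇` sum by telescoping in `n`. -/

/-- The summand of Jackson's very-well-poised balanced `₈φ₇` series, the fourth parameter
being determined by the balancing condition. -/
noncomputable def jacksonTerm (q a c d e : ℂ) (n k : ℕ) : ℂ :=
  (1 - a * q ^ (2 * k)) *
    (qShifted q a k * qShifted q c k * qShifted q d k * qShifted q e k *
      qShifted q (a ^ 2 * q ^ (n + 1) / (c * d * e)) k * qShifted q (q ^ n)⁻¹ k) /
    (qShifted q q k * qShifted q (a * q / c) k * qShifted q (a * q / d) k *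
      qShifted q (a * q / e) k * qShifted q (c * d * e / (a * q ^ n)) k *
      qShifted q (a * q ^ (n + 1)) k) * q ^ k

/-- The antidifference certifying the recurrence of Jackson's sum in `n`. -/
noncomputable def jacksonCertificate (q a c d e : ℂ) (n k : ℕ) : ℂ :=
  -(a * q ^ (n + 1) / (c * d * e)) * (1 - a ^ 2 * q ^ (2 * n + 2) / (c * d * e)) *
    (1 - c * d * e / (a * q ^ (n + 1))) * (1 - a * q ^ (n + 1)) *
    (qShifted q a (k + 1) * qShifted q c (k + 1) * qShifted q d (k + 1) *
      qShifted q e (k + 1) * qShifted q (a ^ 2 * q ^ (n + 2) / (c * d * e)) k *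
      qShifted q (q ^ n)⁻¹ k) /
    (qShifted q q k * qShifted q (a * q / c) k * qShifted q (a * q / d) k *
      qShifted q (a * q / e) k * qShifted q (c * d * e / (a * q ^ (n + 1))) (k + 1) *
      qShifted q (a * q ^ (n + 1)) (k + 1))

/-- What is left of the telescoping relation, with `M = q ^ (n + 1)` and `Z = q ^ (k + 1)`, once the
common `q`-shifted factorials are divided out. -/
theorem jackson_polynomial_identity {a c d e M Z : ℂ} (ha : a ≠ 0) (hc : c ≠ 0) (hd : d ≠ 0)
    (he : e ≠ 0) (hM : M ≠ 0) :
    (1 - a * M / c) * (1 - a * M / d) * (1 - a * M / e) * (1 - a * M / (c * d * e)) *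
        (Z * (1 - a * Z ^ 2) * (1 - a ^ 2 * M * Z / (c * d * e)) * (1 - M⁻¹) * (1 - a * M) *
          (1 - Z * (c * d * e) / (a * M))) -
      (1 - a * M) * (1 - a * M / (c * d)) * (1 - a * M / (c * e)) * (1 - a * M / (d * e)) *
        (Z * (1 - a * Z ^ 2) * (1 - a ^ 2 * M / (c * d * e)) * (1 - Z / M) *
          (1 - c * d * e / (a * M)) * (1 - a * M * Z)) =
    -(a * M / (c * d * e)) * (1 - a ^ 2 * M ^ 2 / (c * d * e)) *
      (1 - c * d * e / (a * M)) * (1 - a * M) *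
      ((1 - a * Z) * (1 - c * Z) * (1 - d * Z) * (1 - e * Z) * (1 - a ^ 2 * M * Z / (c * d * e)) *
          (1 - Z / M) -
        (1 - Z) * (1 - a * Z / c) * (1 - a * Z / d) * (1 - a * Z / e) *
          (1 - Z * (c * d * e) / (a * M)) * (1 - a * M * Z)) := by
  field_simp
  ring

theorem jacksonTerm_sub_eq {q a c d e : ℂ} {n k : ℕ} (hq : q ≠ 0) (ha : a ≠ 0) (hc : c ≠ 0)
    (hd : d ≠ 0) (he : e ≠ 0)
    (h1 : qShifted q q (k + 1) ≠ 0) (h2 : qShifted q (a * q / c) (k + 1) ≠ 0)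
    (h3 : qShifted q (a * q / d) (k + 1) ≠ 0) (h4 : qShifted q (a * q / e) (k + 1) ≠ 0)
    (h5 : qShifted q (c * d * e / (a * q ^ (n + 1))) (k + 2) ≠ 0)
    (h6 : qShifted q (a * q ^ (n + 1)) (k + 2) ≠ 0) :
    (1 - a * q ^ (n + 1) / c) * (1 - a * q ^ (n + 1) / d) * (1 - a * q ^ (n + 1) / e) *
        (1 - a * q ^ (n + 1) / (c * d * e)) * jacksonTerm q a c d e (n + 1) (k + 1) -
      (1 - a * q ^ (n + 1)) * (1 - a * q ^ (n + 1) / (c * d)) *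
        (1 - a * q ^ (n + 1) / (c * e)) * (1 - a * q ^ (n + 1) / (d * e)) *
        jacksonTerm q a c d e n (k + 1) =
    jacksonCertificate q a c d e n (k + 1) - jacksonCertificate q a c d e n k := by
  have core := jackson_polynomial_identity (Z := q ^ (k + 1)) ha hc hd he
    (pow_ne_zero (n + 1) hq)
  unfold jacksonTerm jacksonCertificate
  have hM : q ^ (n + 1) ≠ 0 := pow_ne_zero _ hq
  have e1 : qShifted q (a ^ 2 * q ^ (n + 2) / (c * d * e)) (k + 1) =
      qShifted q (a ^ 2 * q ^ (n + 2) / (c * d * e)) k *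
        (1 - a ^ 2 * q ^ (n + 1) * q ^ (k + 1) / (c * d * e)) := by
    rw [qShifted_succ]; ring
  have e2 : qShifted q (a ^ 2 * q ^ (n + 1) / (c * d * e)) (k + 1) =
      (1 - a ^ 2 * q ^ (n + 1) / (c * d * e)) *
        qShifted q (a ^ 2 * q ^ (n + 2) / (c * d * e)) k := by
    rw [qShifted_succ']; ring_nf
  have e3 : qShifted q (q ^ (n + 1))⁻¹ (k + 1) =
      (1 - (q ^ (n + 1))⁻¹) * qShifted q (q ^ n)⁻¹ k := by
    rw [qShifted_succ']; congr 2; field_simp; ring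
  have e4 : qShifted q (q ^ n)⁻¹ (k + 1) =
      qShifted q (q ^ n)⁻¹ k * (1 - q ^ (k + 1) / q ^ (n + 1)) := by
    rw [qShifted_succ]; congr 2; field_simp; ring
  have e5 : qShifted q (c * d * e / (a * q ^ (n + 1))) (k + 2) =
      qShifted q (c * d * e / (a * q ^ (n + 1))) (k + 1) *
        (1 - q ^ (k + 1) * (c * d * e) / (a * q ^ (n + 1))) := by
    rw [qShifted_succ]; ring
  have e5' : qShifted q (c * d * e / (a * q ^ (n + 1))) (k + 2) =
      (1 - c * d * e / (a * q ^ (n + 1))) * qShifted q (c * d * e / (a * q ^ n)) (k + 1) := by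
    rw [qShifted_succ']; congr 2; field_simp; ring
  have e6 : qShifted q (a * q ^ (n + 1)) (k + 2) =
      qShifted q (a * q ^ (n + 1)) (k + 1) * (1 - a * q ^ (n + 1) * q ^ (k + 1)) := by
    rw [qShifted_succ]
  have e6' : qShifted q (a * q ^ (n + 1)) (k + 2) =
      (1 - a * q ^ (n + 1)) * qShifted q (a * q ^ (n + 1 + 1)) (k + 1) := by
    rw [qShifted_succ', mul_assoc, ← pow_succ]
  have h5' := h5
  have h6' := h6
  rw [e5'] at h5'
  rw [e6'] at h6'
  have p7 := right_ne_zero_of_mul h5'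
  have p8 := right_ne_zero_of_mul h6'
  have p1 := left_ne_zero_of_mul h5'
  have p2 := left_ne_zero_of_mul h6'
  rw [e5] at h5 e5'
  rw [e6] at h6 e6'
  have p3 := left_ne_zero_of_mul h5
  have p4 := right_ne_zero_of_mul h5
  have p5 := left_ne_zero_of_mul h6
  have p6 := right_ne_zero_of_mul h6
  rw [show n + 1 + 1 = n + 2 from rfl] at *
  rw [e1, e2, e3, e4, show k + 1 + 1 = k + 2 from rfl, e5, e6,
    qShifted_succ q a (k + 1), qShifted_succ q c (k + 1), qShifted_succ q d (k + 1),
    qShifted_succ q e (k + 1)]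
  have s1 : qShifted q q (k + 1) = qShifted q q k * (1 - q ^ (k + 1)) := by
    rw [qShifted_succ]; ring
  have s2 (x : ℂ) : qShifted q (a * q / x) (k + 1) =
      qShifted q (a * q / x) k * (1 - a * q ^ (k + 1) / x) := by
    rw [qShifted_succ]; ring
  rw [s1] at h1 ⊢
  rw [s2] at h2 h3 h4
  simp only [s2]
  have t1 := left_ne_zero_of_mul h1
  have t2 := right_ne_zero_of_mul h1
  have t3 := left_ne_zero_of_mul h2
  have t4 := right_ne_zero_of_mul h2
  have t5 := left_ne_zero_of_mul h3
  have t6 := right_ne_zero_of_mul h3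
  have t7 := left_ne_zero_of_mul h4
  have t8 := right_ne_zero_of_mul h4
  rw [show q ^ (2 * (k + 1)) = (q ^ (k + 1)) ^ 2 by ring,
    show q ^ (2 * n + 2) = (q ^ (n + 1)) ^ 2 by ring]
  clear e1 e2 e3 e4 e5 e6 s1 s2 h1 h2 h3 h4 h5 h6 h5' h6'
  -- Every factor becomes an atom. The only equations kept are `core` and `e5'`, `e6'`, which
  -- compare the two base points of the shifted denominators.
  generalize q ^ (k + 1) = Z at *
  generalize q ^ (n + 1) = M at *
  generalize qShifted q a (k + 1) = A at *
  generalize qShifted q c (k + 1) = C at *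
  generalize qShifted q d (k + 1) = D at *
  generalize qShifted q e (k + 1) = E at *
  generalize qShifted q (a ^ 2 * q ^ (n + 2) / (c * d * e)) k = X at *
  generalize qShifted q (q ^ n)⁻¹ k = Y at *
  generalize qShifted q q k = P at *
  generalize qShifted q (a * q / c) k = U at *
  generalize qShifted q (a * q / d) k = V at *
  generalize qShifted q (a * q / e) k = W at *
  generalize qShifted q (c * d * e / (a * M)) (k + 1) = S at *
  generalize qShifted q (a * M) (k + 1) = T at *
  generalize qShifted q (a * q ^ (n + 2)) (k + 1) = T' at *
  generalize qShifted q (c * d * e / (a * q ^ n)) (k + 1) = S' at *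
  generalize 1 - Z = z1 at *
  generalize 1 - a * Z / c = z2 at *
  generalize 1 - a * Z / d = z3 at *
  generalize 1 - a * Z / e = z4 at *
  generalize 1 - Z * (c * d * e) / (a * M) = z5 at *
  generalize 1 - a * M * Z = z6 at *
  generalize 1 - c * d * e / (a * M) = z7 at *
  generalize 1 - a * M = z8 at *
  generalize a * M / (c * d * e) = z9 at *
  generalize 1 - a ^ 2 * M ^ 2 / (c * d * e) = z10 at *
  generalize 1 - a * M / c = y1 at *
  generalize 1 - a * M / d = y2 at *
  generalize 1 - a * M / e = y3 at *
  generalize 1 - a * M / (c * d) = y4 at *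
  generalize 1 - a * M / (c * e) = y5 at *
  generalize 1 - a * M / (d * e) = y6 at *
  generalize 1 - z9 = y7 at *
  generalize 1 - a * Z ^ 2 = y8 at *
  generalize 1 - a ^ 2 * M * Z / (c * d * e) = y9 at *
  generalize 1 - M⁻¹ = y10 at *
  generalize 1 - a ^ 2 * M / (c * d * e) = y11 at *
  generalize 1 - Z / M = y12 at *
  generalize 1 - a * Z = y13 at *
  generalize 1 - c * Z = y14 at *
  generalize 1 - d * Z = y15 at *
  generalize 1 - e * Z = y16 at *
  clear ha hc hd he hM
  -- `Q` is the common factor over the largest denominator; both sides are `Q` times the two sides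
  -- of `core`.
  generalize hQ : A * C * D * E * X * Y /
    (P * z1 * (U * z2) * (V * z3) * (W * z4) * (S * z5) * (T * z6)) = Q
  calc _ = Q * (_ - _) := ?_
    _ = _ := congrArg (Q * ·) core
    _ = _ := ?_
  · have hden : P * z1 * (U * z2) * (V * z3) * (W * z4) * (S * z5) * (T * z6) ≠ 0 := by
      repeat' apply mul_ne_zero
      all_goals assumption
    have hden1 : P * z1 * (U * z2) * (V * z3) * (W * z4) * S * T' ≠ 0 := by
      repeat' apply mul_ne_zero
      all_goals assumption
    have hden2 : P * z1 * (U * z2) * (V * z3) * (W * z4) * S' * T ≠ 0 := by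
      repeat' apply mul_ne_zero
      all_goals assumption
    rw [mul_sub, ← hQ]
    congr 1
    · rw [div_mul_eq_mul_div, mul_div_assoc', div_mul_eq_mul_div, div_eq_div_iff hden1 hden]
      linear_combination (y1 * y2 * y3 * y7 * (y8 * (A * C * D * E * (X * y9) * (y10 * Y)) * Z) *
        (P * z1 * (U * z2) * (V * z3) * (W * z4) * (S * z5))) * e6'
    · rw [div_mul_eq_mul_div, mul_div_assoc', div_mul_eq_mul_div, div_eq_div_iff hden2 hden]
      linear_combination (z8 * y4 * y5 * y6 * (y8 * (A * C * D * E * (y11 * X) * (Y * y12)) * Z) *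
        (P * z1 * (U * z2) * (V * z3) * (W * z4) * (T * z6))) * e5'
  · have key : Q * (z1 * z2 * z3 * z4 * z5 * z6) =
        A * C * D * E * X * Y / (P * U * V * W * S * T) := by
      rw [← hQ, div_mul_eq_mul_div, div_eq_div_iff]
      · ring
      · repeat' apply mul_ne_zero
        all_goals assumption
      · repeat' apply mul_ne_zero
        all_goals assumption
    have key2 : -z9 * z10 * z7 * z8 * (A * C * D * E * X * Y) / (P * U * V * W * S * T) =
        -z9 * z10 * z7 * z8 * (Q * (z1 * z2 * z3 * z4 * z5 * z6)) := by
      rw [key, mul_div_assoc]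
    rw [key2, mul_div_assoc, show A * y13 * (C * y14) * (D * y15) * (E * y16) * (X * y9) *
      (Y * y12) = (y13 * y14 * y15 * y16 * y9 * y12) * (A * C * D * E * X * Y) by ring,
      mul_div_assoc, hQ]
    ring

theorem jacksonTerm_sub_eq_zero {q a c d e : ℂ} {n : ℕ} (hq : q ≠ 0) (ha : a ≠ 0) (hc : c ≠ 0)
    (hd : d ≠ 0) (he : e ≠ 0) (h5 : 1 - c * d * e / (a * q ^ (n + 1)) ≠ 0)
    (h6 : 1 - a * q ^ (n + 1) ≠ 0) :
    (1 - a * q ^ (n + 1) / c) * (1 - a * q ^ (n + 1) / d) * (1 - a * q ^ (n + 1) / e) *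
        (1 - a * q ^ (n + 1) / (c * d * e)) * jacksonTerm q a c d e (n + 1) 0 -
      (1 - a * q ^ (n + 1)) * (1 - a * q ^ (n + 1) / (c * d)) *
        (1 - a * q ^ (n + 1) / (c * e)) * (1 - a * q ^ (n + 1) / (d * e)) *
        jacksonTerm q a c d e n 0 =
    jacksonCertificate q a c d e n 0 := by
  have hM : q ^ (n + 1) ≠ 0 := pow_ne_zero _ hq
  simp only [jacksonTerm, jacksonCertificate, qShifted_succ, qShifted_zero, pow_zero, mul_zero,
    mul_one, one_mul, div_one, zero_add]
  rw [show q ^ (2 * n + 2) = (q ^ (n + 1)) ^ 2 by ring]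
  generalize q ^ (n + 1) = M at *
  rw [eq_div_iff (mul_ne_zero h5 h6)]
  field_simp
  ring

-- The upper boundary of the telescoping. It is separate from `jacksonTerm_sub_eq` because taking `k
-- = n` there would also require `1 - c d e / a ≠ 0`, which comes from the denominator of a term
-- outside the sum.
set_option maxHeartbeats 2000000 in
theorem jacksonTerm_last {q a c d e : ℂ} {n : ℕ} (hq : q ≠ 0) (ha : a ≠ 0) (hc : c ≠ 0)
    (hd : d ≠ 0) (he : e ≠ 0)
    (h1 : qShifted q q (n + 1) ≠ 0) (h2 : qShifted q (a * q / c) (n + 1) ≠ 0)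
    (h3 : qShifted q (a * q / d) (n + 1) ≠ 0) (h4 : qShifted q (a * q / e) (n + 1) ≠ 0)
    (h5 : qShifted q (c * d * e / (a * q ^ (n + 1))) (n + 1) ≠ 0)
    (h6 : qShifted q (a * q ^ (n + 1)) (n + 2) ≠ 0) :
    (1 - a * q ^ (n + 1) / c) * (1 - a * q ^ (n + 1) / d) * (1 - a * q ^ (n + 1) / e) *
        (1 - a * q ^ (n + 1) / (c * d * e)) * jacksonTerm q a c d e (n + 1) (n + 1) =
    -jacksonCertificate q a c d e n n := by
  unfold jacksonTerm jacksonCertificate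
  have hM : q ^ (n + 1) ≠ 0 := pow_ne_zero _ hq
  have e1 : qShifted q (a ^ 2 * q ^ (n + 2) / (c * d * e)) (n + 1) =
      qShifted q (a ^ 2 * q ^ (n + 2) / (c * d * e)) n *
        (1 - a ^ 2 * q ^ (n + 1) * q ^ (n + 1) / (c * d * e)) := by
    rw [qShifted_succ]; ring
  have e3 : qShifted q (q ^ (n + 1))⁻¹ (n + 1) =
      (1 - (q ^ (n + 1))⁻¹) * qShifted q (q ^ n)⁻¹ n := by
    rw [qShifted_succ']; congr 2; field_simp; ring
  have e6 : qShifted q (a * q ^ (n + 1)) (n + 2) =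
      qShifted q (a * q ^ (n + 1)) (n + 1) * (1 - a * q ^ (n + 1) * q ^ (n + 1)) := by
    rw [qShifted_succ]
  have e6' : qShifted q (a * q ^ (n + 1)) (n + 2) =
      (1 - a * q ^ (n + 1)) * qShifted q (a * q ^ (n + 1 + 1)) (n + 1) := by
    rw [qShifted_succ', mul_assoc, ← pow_succ]
  have h6' := h6
  rw [e6'] at h6'
  have g6 : qShifted q (a * q ^ (n + 1 + 1)) (n + 1) =
      qShifted q (a * q ^ (n + 1)) (n + 2) / (1 - a * q ^ (n + 1)) := by
    rw [eq_div_iff (left_ne_zero_of_mul h6'), e6', mul_comm]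
  have p2 := left_ne_zero_of_mul h6'
  rw [e6] at h6 g6
  have p5 := left_ne_zero_of_mul h6
  have p6 := right_ne_zero_of_mul h6
  rw [show n + 1 + 1 = n + 2 from rfl] at *
  rw [e1, e3, g6]
  have s1 : qShifted q q (n + 1) = qShifted q q n * (1 - q ^ (n + 1)) := by
    rw [qShifted_succ]; ring
  have s2 (x : ℂ) : qShifted q (a * q / x) (n + 1) =
      qShifted q (a * q / x) n * (1 - a * q ^ (n + 1) / x) := by
    rw [qShifted_succ]; ring
  rw [s1] at h1 ⊢
  rw [s2] at h2 h3 h4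
  simp only [s2]
  have t1 := left_ne_zero_of_mul h1
  have t2 := right_ne_zero_of_mul h1
  have t3 := left_ne_zero_of_mul h2
  have t4 := right_ne_zero_of_mul h2
  have t5 := left_ne_zero_of_mul h3
  have t6 := right_ne_zero_of_mul h3
  have t7 := left_ne_zero_of_mul h4
  have t8 := right_ne_zero_of_mul h4
  have core : (1 - a * q ^ (n + 1) / (c * d * e)) * (1 - (q ^ (n + 1))⁻¹) * q ^ (n + 1) =
      (a * q ^ (n + 1) / (c * d * e)) * (1 - c * d * e / (a * q ^ (n + 1))) *
      (1 - q ^ (n + 1)) := by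
    field_simp
    ring
  rw [show q ^ (2 * (n + 1)) = q ^ (n + 1) * q ^ (n + 1) by ring,
    show q ^ (2 * n + 2) = q ^ (n + 1) * q ^ (n + 1) by ring]
  clear e1 e3 e6 e6' g6 s1 s2 h1 h2 h3 h4 h6 h6'
  generalize q ^ (n + 1) = M at *
  simp only [mul_assoc a M M, mul_assoc (a ^ 2) M M] at *
  generalize qShifted q a (n + 1) = A at *
  generalize qShifted q c (n + 1) = C at *
  generalize qShifted q d (n + 1) = D at *
  generalize qShifted q e (n + 1) = E at *
  generalize qShifted q (a ^ 2 * q ^ (n + 2) / (c * d * e)) n = X at *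
  generalize qShifted q (q ^ n)⁻¹ n = Y at *
  generalize qShifted q q n = P at *
  generalize qShifted q (a * q / c) n = U at *
  generalize qShifted q (a * q / d) n = V at *
  generalize qShifted q (a * q / e) n = W at *
  generalize qShifted q (c * d * e / (a * M)) (n + 1) = S at *
  generalize qShifted q (a * M) (n + 1) = T at *
  generalize 1 - a * M / c = z2 at *
  generalize 1 - a * M / d = z3 at *
  generalize 1 - a * M / e = z4 at *
  generalize 1 - a * (M * M) = z6 at *
  generalize 1 - a * M = z8 at *
  generalize 1 - a ^ 2 * (M * M) / (c * d * e) = z10 at *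
  generalize 1 - c * d * e / (a * M) = z7 at *
  generalize a * M / (c * d * e) = z9 at *
  generalize 1 - M⁻¹ = z11 at *
  have fin := congrArg (fun x => x * (A * C * D * E * X * Y * z10 * z8 /
    (P * (1 - M) * U * V * W * S * T))) core
  calc _ = _ := ?_
    _ = _ := fin
    _ = _ := ?_
  · field_simp
  · field_simp

theorem sum_jacksonTerm_succ {q a c d e : ℂ} {n : ℕ} (hq : q ≠ 0) (ha : a ≠ 0) (hc : c ≠ 0)
    (hd : d ≠ 0) (he : e ≠ 0)
    (h1 : qShifted q q (n + 1) ≠ 0) (h2 : qShifted q (a * q / c) (n + 1) ≠ 0)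
    (h3 : qShifted q (a * q / d) (n + 1) ≠ 0) (h4 : qShifted q (a * q / e) (n + 1) ≠ 0)
    (h5 : qShifted q (c * d * e / (a * q ^ (n + 1))) (n + 1) ≠ 0)
    (h6 : qShifted q (a * q ^ (n + 1)) (n + 2) ≠ 0) :
    (1 - a * q ^ (n + 1) / c) * (1 - a * q ^ (n + 1) / d) * (1 - a * q ^ (n + 1) / e) *
        (1 - a * q ^ (n + 1) / (c * d * e)) *
        ∑ k ∈ range (n + 2), jacksonTerm q a c d e (n + 1) k =
      (1 - a * q ^ (n + 1)) * (1 - a * q ^ (n + 1) / (c * d)) *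
        (1 - a * q ^ (n + 1) / (c * e)) * (1 - a * q ^ (n + 1) / (d * e)) *
        ∑ k ∈ range (n + 1), jacksonTerm q a c d e n k := by
  -- The certificate is the partial sum of the differences, not just an antidifference of them:
  -- there is no constant term at `k = 0`.
  have key : ∀ k ≤ n,
      (1 - a * q ^ (n + 1) / c) * (1 - a * q ^ (n + 1) / d) * (1 - a * q ^ (n + 1) / e) *
        (1 - a * q ^ (n + 1) / (c * d * e)) *
        ∑ k ∈ range (k + 1), jacksonTerm q a c d e (n + 1) k -
      (1 - a * q ^ (n + 1)) * (1 - a * q ^ (n + 1) / (c * d)) *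
        (1 - a * q ^ (n + 1) / (c * e)) * (1 - a * q ^ (n + 1) / (d * e)) *
        ∑ k ∈ range (k + 1), jacksonTerm q a c d e n k = jacksonCertificate q a c d e n k := by
    intro k
    induction k with
    | zero =>
      intro _
      simp only [zero_add, sum_range_one]
      refine jacksonTerm_sub_eq_zero hq ha hc hd he ?_ ?_
      · simpa using (qShifted_ne_zero_iff _ _ _).1 h5 0 (by omega)
      · simpa using (qShifted_ne_zero_iff _ _ _).1 h6 0 (by omega)
    | succ k ih =>
      intro hk
      have h := ih (by omega)
      have h' := jacksonTerm_sub_eq (k := k) (n := n) hq ha hc hd he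
        (qShifted_ne_zero_of_le q h1 (by omega)) (qShifted_ne_zero_of_le q h2 (by omega))
        (qShifted_ne_zero_of_le q h3 (by omega)) (qShifted_ne_zero_of_le q h4 (by omega))
        (qShifted_ne_zero_of_le q h5 (by omega)) (qShifted_ne_zero_of_le q h6 (by omega))
      rw [sum_range_succ _ (k + 1), sum_range_succ _ (k + 1)]
      linear_combination h + h'
  have h := key n le_rfl
  rw [sum_range_succ _ (n + 1)]
  linear_combination h + jacksonTerm_last hq ha hc hd he h1 h2 h3 h4 h5 h6

/-- Jackson's sum of a terminating balanced very-well-poised `₈φ₇` series. -/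
theorem sum_jacksonTerm {q a c d e : ℂ} (hq : q ≠ 0) (hq1 : ∀ k, qShifted q q k ≠ 0)
    (ha : a ≠ 0) (hc : c ≠ 0) (hd : d ≠ 0) (he : e ≠ 0) (n : ℕ)
    (h2 : qShifted q (a * q / c) n ≠ 0)
    (h3 : qShifted q (a * q / d) n ≠ 0) (h4 : qShifted q (a * q / e) n ≠ 0)
    (h5 : qShifted q (c * d * e / (a * q ^ n)) n ≠ 0)
    (h6 : qShifted q (a * q) (2 * n) ≠ 0) (h7 : qShifted q (a * q / (c * d * e)) n ≠ 0) :
    ∑ k ∈ range (n + 1), jacksonTerm q a c d e n k =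
      (1 - a) * (qShifted q (a * q) n * qShifted q (a * q / (c * d)) n *
        qShifted q (a * q / (c * e)) n * qShifted q (a * q / (d * e)) n) /
      (qShifted q (a * q / c) n * qShifted q (a * q / d) n * qShifted q (a * q / e) n *
        qShifted q (a * q / (c * d * e)) n) := by
  induction n with
  | zero => simp [jacksonTerm]
  | succ n ih =>
    -- The base point of this factorial depends on `n`, so passing from `n + 1` to `n` drops its
    -- first factor rather than its last.
    have h5' : qShifted q (c * d * e / (a * q ^ n)) n ≠ 0 := by
      rw [qShifted_succ'] at h5
      convert right_ne_zero_of_mul h5 using 2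
      field_simp
      ring
    have h := ih (qShifted_ne_zero_of_le q h2 (by omega)) (qShifted_ne_zero_of_le q h3 (by omega))
      (qShifted_ne_zero_of_le q h4 (by omega)) h5' (qShifted_ne_zero_of_le q h6 (by omega))
      (qShifted_ne_zero_of_le q h7 (by omega))
    have h6' : qShifted q (a * q ^ (n + 1)) (n + 2) ≠ 0 := by
      rw [show 2 * (n + 1) = n + (n + 2) by ring, qShifted_add] at h6
      convert right_ne_zero_of_mul h6 using 2
      ring
    have h' := sum_jacksonTerm_succ hq ha hc hd he (hq1 _) h2 h3 h4 h5 h6'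
    rw [h] at h'
    have s2 (x : ℂ) : qShifted q (a * q / x) (n + 1) =
      qShifted q (a * q / x) n * (1 - a * q ^ (n + 1) / x) := by
      rw [qShifted_succ]; ring
    have s1 : qShifted q (a * q) (n + 1) = qShifted q (a * q) n * (1 - a * q ^ (n + 1)) := by
      rw [qShifted_succ]; ring
    simp only [s2] at h2 h3 h4 h7 ⊢
    rw [s1]
    have t1 := left_ne_zero_of_mul h2
    have t2 := right_ne_zero_of_mul h2
    have t3 := left_ne_zero_of_mul h3
    have t4 := right_ne_zero_of_mul h3
    have t5 := left_ne_zero_of_mul h4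
    have t6 := right_ne_zero_of_mul h4
    have t7 := left_ne_zero_of_mul h7
    have t8 := right_ne_zero_of_mul h7
    refine mul_left_cancel₀ (mul_ne_zero (mul_ne_zero (mul_ne_zero t2 t4) t6) t8) (h'.trans ?_)
    clear h' h ih h2 h3 h4 h5 h6 h7 h5' h6' s1 s2
    generalize 1 - a * q ^ (n + 1) / c = z2 at *
    generalize 1 - a * q ^ (n + 1) / d = z3 at *
    generalize 1 - a * q ^ (n + 1) / e = z4 at *
    generalize 1 - a * q ^ (n + 1) / (c * d * e) = z5 at *
    field_simp

/-! ### A Vandermonde-type determinant with two families of nodes. -/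

theorem det_prod_sub_mul_prod_sub_of_injective {R : Type*} [CommRing R] [IsDomain R] {r : ℕ}
    (x : Fin r → R) (u w : ℕ → R) (hu : Function.Injective fun i : Fin r => u i) :
    (Matrix.of fun i j : Fin r =>
      (∏ l ∈ range (j : ℕ), (x i - u l)) * ∏ l ∈ range (r - 1 - (j : ℕ)), (x i - w l)).det =
    (∏ i : Fin r, ∏ j ∈ Ioi i, (x j - x i)) *
      ∏ j : Fin r, ∏ l ∈ range (r - 1 - (j : ℕ)), (u j - w l) := by
  let p (j : Fin r) : Polynomial R := (∏ l ∈ range (j : ℕ), (Polynomial.X - Polynomial.C (u l))) *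
    ∏ l ∈ range (r - 1 - (j : ℕ)), (Polynomial.X - Polynomial.C (w l))
  have hp (j : Fin r) : (p j).natDegree < r := by
    have : (p j).natDegree = r - 1 := by
      have h1 : (∏ l ∈ range (j : ℕ), (Polynomial.X - Polynomial.C (u l))).Monic :=
        Polynomial.monic_prod_of_monic _ _ fun l _ => Polynomial.monic_X_sub_C _
      have h2 : (∏ l ∈ range (r - 1 - (j : ℕ)), (Polynomial.X - Polynomial.C (w l))).Monic :=
        Polynomial.monic_prod_of_monic _ _ fun l _ => Polynomial.monic_X_sub_C _
      rw [h1.natDegree_mul h2, Polynomial.natDegree_prod_of_monic _ _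
        fun l _ => Polynomial.monic_X_sub_C _, Polynomial.natDegree_prod_of_monic _ _
        fun l _ => Polynomial.monic_X_sub_C _]
      simp
      omega
    have := j.2
    omega
  let C : Matrix (Fin r) (Fin r) R := Matrix.of fun k j => (p j).coeff k
  have key (y : Fin r → R) : (Matrix.of fun i j : Fin r =>
      (∏ l ∈ range (j : ℕ), (y i - u l)) * ∏ l ∈ range (r - 1 - (j : ℕ)), (y i - w l)) =
      Matrix.vandermonde y * C := by
    ext i j
    have : (p j).eval (y i) =
      (∏ l ∈ range (j : ℕ), (y i - u l)) * ∏ l ∈ range (r - 1 - (j : ℕ)), (y i - w l) := by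
      simp [p, Polynomial.eval_mul, Polynomial.eval_prod]
    rw [Matrix.of_apply, ← this, Polynomial.eval_eq_sum_range' (hp j), Matrix.mul_apply,
      ← Fin.sum_univ_eq_sum_range fun k => (p j).coeff k * y i ^ k]
    exact sum_congr rfl fun k _ => by simp [C, Matrix.vandermonde, mul_comm]
  -- `C` does not depend on the points, so they may be specialised to the nodes `u`. The matrix is
  -- then lower triangular, and the Vandermonde determinant of the distinct `u i` can be cancelled.
  have hC : C.det = ∏ j : Fin r, ∏ l ∈ range (r - 1 - (j : ℕ)), (u j - w l) := by
    have h := congrArg Matrix.det (key fun i => u i)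
    rw [Matrix.det_mul, Matrix.det_of_isLowerTriangular] at h
    · have hV := Matrix.det_vandermonde_ne_zero_iff.2 hu
      refine mul_left_cancel₀ hV (h.symm.trans ?_)
      simp only [Matrix.of_apply, prod_mul_distrib]
      congr 1
      rw [Matrix.det_vandermonde]
      have (j : Fin r) : ∏ l ∈ range (j : ℕ), (u j - u l) = ∏ i ∈ Iio j, (u j - u i) := by
        rw [← Nat.Iio_eq_range, ← Fin.map_valEmbedding_Iio, prod_map]
        rfl
      simp_rw [this]
      exact prod_comm' fun i j => by simp
    · intro i j hij
      have hij' : i < j := hij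
      rw [Matrix.of_apply]
      exact mul_eq_zero_of_left (prod_eq_zero (mem_range.2 hij') (sub_self _)) _
  rw [key, Matrix.det_mul, hC, Matrix.det_vandermonde]

/-- Coinciding nodes are separated by the perturbation `u l + l X` over `ℂ[X]`; evaluation at `X =
0` then gives the identity for arbitrary `u`. -/
theorem det_prod_sub_mul_prod_sub {r : ℕ} (x : Fin r → ℂ) (u w : ℕ → ℂ) :
    (Matrix.of fun i j : Fin r =>
      (∏ l ∈ range (j : ℕ), (x i - u l)) * ∏ l ∈ range (r - 1 - (j : ℕ)), (x i - w l)).det =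
    (∏ i : Fin r, ∏ j ∈ Ioi i, (x j - x i)) *
      ∏ j : Fin r, ∏ l ∈ range (r - 1 - (j : ℕ)), (u j - w l) := by
  have h := det_prod_sub_mul_prod_sub_of_injective (R := Polynomial ℂ)
    (fun i => Polynomial.C (x i)) (fun l => Polynomial.C (u l) + Polynomial.C (l : ℂ) * Polynomial.X)
    (fun l => Polynomial.C (w l)) (by
      intro i j hij
      have := congrArg (fun p => Polynomial.coeff p 1) hij
      simpa [Polynomial.coeff_C, Fin.ext_iff] using this)
  have h' := congrArg (Polynomial.evalRingHom (0 : ℂ)) h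
  rw [RingHom.map_det] at h'
  simp only [map_mul, map_prod, map_sub, Polynomial.coe_evalRingHom, Polynomial.eval_C,
    Polynomial.eval_add, Polynomial.eval_mul, Polynomial.eval_X, mul_zero, add_zero] at h'
  rw [← h']
  congr 1
  ext i j
  simp [Polynomial.eval_prod]

/-! ### Reversal of `q`-shifted factorials. -/

theorem prod_one_sub_div_pow {q : ℂ} (hq : q ≠ 0) (x : ℂ) (s : ℕ) :
    ∏ l ∈ range s, (1 - x / q ^ l) = qShifted q (x * q / q ^ s) s := by
  rw [qShifted, ← prod_range_reflect]
  refine prod_congr rfl fun j hj => ?_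
  rw [mem_range] at hj
  obtain ⟨t, rfl⟩ : ∃ t, s = t + j + 1 := ⟨s - j - 1, by omega⟩
  rw [show t + j + 1 - 1 - j = t by omega]
  field_simp
  ring

theorem qShifted_inversion {q : ℂ} (hq : q ≠ 0) {x : ℂ} (hx : x ≠ 0) (m : ℕ) :
    qShifted q x m = (-x) ^ m * q ^ m.choose 2 * qShifted q (q / (x * q ^ m)) m := by
  rw [show q / (x * q ^ m) = x⁻¹ * q / q ^ m by field_simp, ← prod_one_sub_div_pow hq]
  induction m with
  | zero => simp
  | succ m ih =>
    rw [qShifted_succ, ih, prod_range_succ, Nat.choose_succ_succ', Nat.choose_one_right]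
    field_simp
    ring

theorem choose_two_mul_two (m : ℕ) : (2 * m).choose 2 = 4 * m.choose 2 + m := by
  induction m with
  | zero => rfl
  | succ m ih =>
    rw [show 2 * (m + 1) = 2 * m + 1 + 1 by ring, Nat.choose_succ_succ' (2 * m + 1) 1,
      Nat.choose_succ_succ' (2 * m) 1, ih, Nat.choose_succ_succ' m 1]
    simp only [Nat.choose_one_right]
    ring

/-! ### The single sums: absorbing the determinant entries into Jackson's series. -/

/-- The summand, in one summation index, of the multiple series. -/
noncomputable def wellPoisedTerm (q a b c d e : ℂ) (n k : ℕ) : ℂ :=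
  (1 - a * q ^ (2 * k)) *
    (qShifted q a k * qShifted q b k * qShifted q c k * qShifted q d k * qShifted q e k *
      qShifted q (q ^ n)⁻¹ k) /
    ((1 - a) * (qShifted q q k * qShifted q (a * q / b) k * qShifted q (a * q / c) k *
      qShifted q (a * q / d) k * qShifted q (a * q / e) k * qShifted q (a * q ^ (1 + n)) k)) *
    q ^ k

/-- A polynomial of degree `m + s` in `q ^ k + 1 / (a q ^ k)`, up to a factor `q ^ (k (m + s))`. -/
noncomputable def shiftFactor (q a b : ℂ) (m s k : ℕ) : ℂ :=
  qShifted q (q ^ k * q / q ^ m) m * qShifted q (a * q ^ k) m * qShifted q (b * q ^ k) s *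
    qShifted q (a * q ^ k / b * q / q ^ s) s

theorem shiftFactor_eq_zero {q : ℂ} (hq : q ≠ 0) (a b : ℂ) {m s k : ℕ} (h : k < m) :
    shiftFactor q a b m s k = 0 := by
  have : qShifted q (q ^ k * q / q ^ m) m = 0 := by
    refine prod_eq_zero (i := m - 1 - k) (mem_range.2 (by omega)) ?_
    obtain ⟨t, rfl⟩ : ∃ t, m = t + k + 1 := ⟨m - k - 1, by omega⟩
    rw [show t + k + 1 - 1 - k = t by omega]
    field_simp
    ring
  simp [shiftFactor, this]

/-- Each of the four pieces of `shiftFactor` merges with one factorial of the summand: `(q)_k` is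
cut to `(q)_{k-m}`, `(a)_k` and `(b)_k` are lengthened by `m` and `s`, and the base of `(aq/b)_k`
moves to `aq/(b q^s)`. Splitting off the first `m` factors elsewhere leaves a Jackson term, whose
fourth parameter is `b q ^ (s + m)` by the balancing condition. -/
theorem wellPoisedTerm_mul_shiftFactor {q a b c d e : ℂ} {m s p k : ℕ} (hq : q ≠ 0) (ha : a ≠ 0)
    (hb : b ≠ 0) (hc : c ≠ 0) (hd : d ≠ 0) (he : e ≠ 0)
    (hbal : b * c * d * e * q ^ s = a ^ 2 * q ^ (p + 1))
    (hq1 : ∀ k, qShifted q q k ≠ 0)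
    (hB : qShifted q (a * q / (b * q ^ s)) (s + (m + k)) ≠ 0) :
    wellPoisedTerm q a b c d e (m + p) (m + k) * shiftFactor q a b m s (m + k) =
      q ^ m / (1 - a) * (qShifted q a (2 * m) * qShifted q b (s + m) * qShifted q c m *
        qShifted q d m * qShifted q e m * qShifted q (q ^ (m + p))⁻¹ m) *
      (qShifted q (a * q / (b * q ^ s)) s / qShifted q (a * q / (b * q ^ s)) m) /
      (qShifted q (a * q / c) m * qShifted q (a * q / d) m * qShifted q (a * q / e) m *
        qShifted q (a * q ^ (1 + (m + p))) m) *
      jacksonTerm q (a * q ^ (2 * m)) (c * q ^ m) (d * q ^ m) (e * q ^ m) p k := by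
  have h1 : qShifted q a (m + k) * qShifted q (a * q ^ (m + k)) m =
      qShifted q a (2 * m) * qShifted q (a * q ^ (2 * m)) k := by
    rw [← qShifted_add, ← qShifted_add]; congr 1; ring
  have h2 : qShifted q q (m + k) = qShifted q q k * qShifted q (q ^ (m + k) * q / q ^ m) m := by
    rw [add_comm m k, qShifted_add]; congr 2; field_simp; ring
  have h3 : qShifted q b (m + k) * qShifted q (b * q ^ (m + k)) s =
      qShifted q b (s + m) * qShifted q (b * q ^ (s + m)) k := by
    rw [← qShifted_add, ← qShifted_add]; congr 1; ring
  have h4 : qShifted q (a * q / (b * q ^ s)) s * qShifted q (a * q / b) (m + k) =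
      qShifted q (a * q / (b * q ^ s)) m *
        qShifted q (a * q ^ (2 * m + 1) / (b * q ^ (s + m))) k *
        qShifted q (a * q ^ (m + k) / b * q / q ^ s) s := by
    have e1 : a * q / b = a * q / (b * q ^ s) * q ^ s := by field_simp
    have e2 : a * q ^ (2 * m + 1) / (b * q ^ (s + m)) = a * q / (b * q ^ s) * q ^ m := by
      field_simp; ring
    have e3 : a * q ^ (m + k) / b * q / q ^ s = a * q / (b * q ^ s) * q ^ (m + k) := by
      field_simp
    rw [e1, e2, e3, ← qShifted_add, ← qShifted_add, ← qShifted_add, add_comm]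
  have h5 : a * q ^ (2 * m + 1) / (b * q ^ (s + m)) =
      c * q ^ m * (d * q ^ m) * (e * q ^ m) / (a * q ^ (2 * m) * q ^ p) := by
    rw [div_eq_div_iff (by simp [*]) (by simp [*])]
    linear_combination (-q ^ (4 * m)) * hbal
  have h6 : b * q ^ (s + m) = (a * q ^ (2 * m)) ^ 2 * q ^ (p + 1) /
      (c * q ^ m * (d * q ^ m) * (e * q ^ m)) := by
    rw [eq_div_iff (by simp [*])]
    linear_combination (q ^ (4 * m)) * hbal
  have h7 (x : ℂ) (hx : x ≠ 0) : qShifted q (a * q / x) (m + k) = qShifted q (a * q / x) m *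
      qShifted q (a * q ^ (2 * m) * q / (x * q ^ m)) k := by
    rw [qShifted_add]; congr 2; field_simp; ring
  have h8 : qShifted q (q ^ (m + p))⁻¹ (m + k) =
      qShifted q (q ^ (m + p))⁻¹ m * qShifted q (q ^ p)⁻¹ k := by
    rw [qShifted_add]; congr 2; field_simp; ring
  have h9 : qShifted q (a * q ^ (1 + (m + p))) (m + k) =
      qShifted q (a * q ^ (1 + (m + p))) m * qShifted q (a * q ^ (2 * m) * q ^ (p + 1)) k := by
    rw [qShifted_add]; congr 2; ring
  rw [h5] at h4
  rw [h6] at h3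
  rw [qShifted_add, show a * q / (b * q ^ s) * q ^ s = a * q / b by field_simp, h4] at hB
  have hB1 := right_ne_zero_of_mul hB
  have hB2 := left_ne_zero_of_mul hB
  have k1 : qShifted q (a * q ^ (m + k) / b * q / q ^ s) s / qShifted q (a * q / b) (m + k) =
      qShifted q (a * q / (b * q ^ s)) s / qShifted q (a * q / (b * q ^ s)) m /
       qShifted q (c * q ^ m * (d * q ^ m) * (e * q ^ m) / (a * q ^ (2 * m) * q ^ p)) k := by
    rw [div_div, div_eq_div_iff, h4, mul_comm]
    · intro h; rw [h, mul_zero] at h4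
      exact hB h4.symm
    · exact hB2
  have k2 : qShifted q (q ^ (m + k) * q / q ^ m) m / qShifted q q (m + k) =
      1 / qShifted q q k := by
    have := hq1 (m + k)
    rw [h2] at this ⊢
    have t1 := left_ne_zero_of_mul this
    have t2 := right_ne_zero_of_mul this
    field_simp
  unfold wellPoisedTerm shiftFactor jacksonTerm
  generalize 1 - a = w
  calc _ = q ^ m / w * (1 - a * q ^ (2 * (m + k))) *
        (qShifted q a (m + k) * qShifted q (a * q ^ (m + k)) m) *
        (qShifted q b (m + k) * qShifted q (b * q ^ (m + k)) s) *
        (qShifted q c (m + k) * qShifted q d (m + k) * qShifted q e (m + k) *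
          qShifted q (q ^ (m + p))⁻¹ (m + k)) *
        (qShifted q (q ^ (m + k) * q / q ^ m) m / qShifted q q (m + k)) *
        (qShifted q (a * q ^ (m + k) / b * q / q ^ s) s / qShifted q (a * q / b) (m + k)) /
        (qShifted q (a * q / c) (m + k) * qShifted q (a * q / d) (m + k) *
          qShifted q (a * q / e) (m + k) * qShifted q (a * q ^ (1 + (m + p))) (m + k)) *
        q ^ k := by ring
    _ = _ := by
      rw [h1, h3, k1, k2, h7 c hc, h7 d hd, h7 e he, h8, h9, qShifted_add q c, qShifted_add q d,
        qShifted_add q e]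
      ring

/-- Jackson's sum of length `p = n - m` produces factorials of length `p` with shifted parameters.
Completing them to length `n` leaves factorials of length `m`, which the balancing condition and
reversal turn into the denominators on the right. `hgen` makes every instance of Jackson's
recurrence down to length zero legitimate. -/
theorem sum_wellPoisedTerm_mul_shiftFactor_of_generic {q a b c d e : ℂ} {m s n : ℕ}
    (hq : q ≠ 0) (hq1 : ∀ k, qShifted q q k ≠ 0) (ha : a ≠ 0)
    (hb : b ≠ 0) (hc : c ≠ 0) (hd : d ≠ 0) (he : e ≠ 0)
    (hbal : b * c * d * e * q ^ (s + m) = a ^ 2 * q ^ (n + 1))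
    (hgen : qShifted q a (2 * n + 1) ≠ 0)
    (hB : qShifted q (a * q / (b * q ^ (s + m))) (s + m + n) ≠ 0)
    (hC : qShifted q (a * q / c) n ≠ 0) (hD : qShifted q (a * q / d) n ≠ 0)
    (hE : qShifted q (a * q / e) n ≠ 0)
    (hZ : qShifted q (a * q / (c * d * e)) n ≠ 0)
    (hBC : qShifted q (a * q / (b * c * q ^ (s + m))) (s + m) ≠ 0)
    (hBD : qShifted q (a * q / (b * d * q ^ (s + m))) (s + m) ≠ 0)
    (hBE : qShifted q (a * q / (b * e * q ^ (s + m))) (s + m) ≠ 0)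
    (hBN : qShifted q (a * q ^ (n + 1) / (b * q ^ (s + m))) (s + m) ≠ 0) :
    ∑ k ∈ range (n + 1), wellPoisedTerm q a b c d e n k * shiftFactor q a b m s k =
      qShifted q b (s + m) * qShifted q (a * q / (b * q ^ (s + m))) (s + m) *
        (q / (b * q ^ (s + m))) ^ m *
      ((qShifted q (a * q) n * qShifted q (a * q / (c * d)) n * qShifted q (a * q / (c * e)) n *
        qShifted q (a * q / (d * e)) n) /
      (qShifted q (a * q / c) n * qShifted q (a * q / d) n * qShifted q (a * q / e) n *
        qShifted q (a * q / (c * d * e)) n)) *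
      ((qShifted q c m * qShifted q d m * qShifted q e m * qShifted q (q ^ n)⁻¹ m) /
        (qShifted q (a * q / (b * c * q ^ (s + m))) m *
          qShifted q (a * q / (b * d * q ^ (s + m))) m *
          qShifted q (a * q / (b * e * q ^ (s + m))) m *
          qShifted q (a * q ^ (n + 1) / (b * q ^ (s + m))) m)) := by
  -- For `n < m` both sides vanish: `(q⁻ⁿ)_m = 0` on the right, and the shift factor kills every `k
  -- ≤ n` on the left.
  rcases lt_or_ge n m with hnm | hnm
  · rw [qShifted_inv_pow_eq_zero q hq hnm, mul_zero, zero_div, mul_zero]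
    refine sum_eq_zero fun k hk => ?_
    rw [shiftFactor_eq_zero hq a b (by rw [mem_range] at hk; omega), mul_zero]
  obtain ⟨p, rfl⟩ := Nat.exists_eq_add_of_le hnm
  have hbal' : b * c * d * e * q ^ s = a ^ 2 * q ^ (p + 1) := by
    refine mul_right_cancel₀ (pow_ne_zero m hq) ?_
    linear_combination hbal
  have hqm : q ^ m ≠ 0 := pow_ne_zero _ hq
  have hqs : q ^ s ≠ 0 := pow_ne_zero _ hq
  rw [show range (m + p + 1) = range (m + (p + 1)) from rfl, sum_range_add,
    sum_eq_zero (s := range m) fun k hk => by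
      rw [shiftFactor_eq_zero hq a b (mem_range.1 hk), mul_zero], zero_add]
  have hγ : a * q / (b * q ^ s) = a * q / (b * q ^ (s + m)) * q ^ m := by
    field_simp; ring
  have hterm (k : ℕ) (hk : k ∈ range (p + 1)) :=
    wellPoisedTerm_mul_shiftFactor (m := m) (k := k) hq ha hb hc hd he hbal' hq1 (by
      have : qShifted q (a * q / (b * q ^ (s + m))) (m + (s + (m + k))) ≠ 0 :=
        qShifted_ne_zero_of_le q hB (by rw [mem_range] at hk; omega)
      rw [qShifted_add, ← hγ] at this
      exact right_ne_zero_of_mul this)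
  have hx (x : ℂ) (hx : x ≠ 0) : qShifted q (a * q / x) (m + p) = qShifted q (a * q / x) m *
      qShifted q (a * q ^ (2 * m) * q / (x * q ^ m)) p := by
    rw [qShifted_add]; congr 2; field_simp; ring
  have hB5 : qShifted q (c * q ^ m * (d * q ^ m) * (e * q ^ m) / (a * q ^ (2 * m) * q ^ p)) p ≠ 0 := by
    have h : qShifted q (a * q / (b * q ^ (s + m))) (2 * m + p) ≠ 0 :=
      qShifted_ne_zero_of_le q hB (by omega)
    rw [qShifted_add] at h
    convert right_ne_zero_of_mul h using 2
    rw [div_mul_eq_mul_div, div_eq_div_iff (by simp [*]) (by simp [*])]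
    linear_combination (q ^ (4 * m)) * hbal'
  have hY0 : a * q ^ (2 * m) * q / (c * q ^ m * (d * q ^ m) * (e * q ^ m)) =
      a * q / (c * d * e * q ^ m) := by
    field_simp; ring
  have hZ' : qShifted q (a * q ^ (2 * m) * q / (c * q ^ m * (d * q ^ m) * (e * q ^ m))) p ≠ 0 := by
    rw [qShifted_inversion hq (by simp [*])]
    refine mul_ne_zero (by simp [*]) ?_
    convert hB5 using 2
    field_simp
  have hJ := sum_jacksonTerm (a := a * q ^ (2 * m)) (c := c * q ^ m) (d := d * q ^ m)
    (e := e * q ^ m) hq hq1 (by simp [*]) (by simp [*]) (by simp [*]) (by simp [*]) p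
    (right_ne_zero_of_mul (hx c hc ▸ hC)) (right_ne_zero_of_mul (hx d hd ▸ hD))
    (right_ne_zero_of_mul (hx e he ▸ hE)) hB5 (by
      rw [show 2 * (m + p) + 1 = 2 * m + 1 + 2 * p by ring, qShifted_add, pow_succ,
        ← mul_assoc] at hgen
      exact right_ne_zero_of_mul hgen) hZ'
  have h1a : 1 - a ≠ 0 := by
    simpa using (qShifted_ne_zero_iff _ _ _).1 hgen 0 (by omega)
  have hX : qShifted q (a * q ^ (1 + (m + p))) m ≠ 0 := by
    have : qShifted q a (1 + (m + p) + m) ≠ 0 := qShifted_ne_zero_of_le q hgen (by omega)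
    rw [qShifted_add] at this
    exact right_ne_zero_of_mul this
  have rA : qShifted q a (2 * m) * (1 - a * q ^ (2 * m)) * qShifted q (a * q ^ (2 * m) * q) p /
      ((1 - a) * qShifted q (a * q ^ (1 + (m + p))) m) = qShifted q (a * q) (m + p) := by
    rw [div_eq_iff (mul_ne_zero h1a hX), mul_assoc, ← qShifted_succ', ← qShifted_add,
      show a * q ^ (1 + (m + p)) = a * q * q ^ (m + p) by ring,
      mul_left_comm, ← qShifted_add, ← qShifted_succ']
    congr 1; ring
  have hγ2 : qShifted q (a * q / (b * q ^ (s + m))) (2 * m) ≠ 0 :=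
    qShifted_ne_zero_of_le q hB (by omega)
  have hβ : qShifted q (a * q / (b * q ^ s)) m ≠ 0 := by
    rw [two_mul, qShifted_add, ← hγ] at hγ2
    exact right_ne_zero_of_mul hγ2
  have rβ : qShifted q (a * q / (b * q ^ s)) s / qShifted q (a * q / (b * q ^ s)) m =
      qShifted q (a * q / (b * q ^ (s + m))) (s + m) /
        qShifted q (a * q / (b * q ^ (s + m))) (2 * m) := by
    rw [div_eq_div_iff hβ hγ2, two_mul, qShifted_add, add_comm s m, qShifted_add, add_comm m s,
      ← hγ]
    ring
  have rP (x y z : ℂ) (hx : x ≠ 0) (hy : y ≠ 0) (hz : z ≠ 0)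
      (h : b * x * y * z * q ^ s = a ^ 2 * q ^ (p + 1))
      (hn : qShifted q (a * q / (b * z * q ^ (s + m))) (s + m) ≠ 0) :
      qShifted q (a * q ^ (2 * m) * q / (x * q ^ m * (y * q ^ m))) p =
      qShifted q (a * q / (x * y)) (m + p) / ((-(b * z * q ^ s / a)) ^ m * q ^ m.choose 2 *
        qShifted q (a * q / (b * z * q ^ (s + m))) m) := by
    have hn' := qShifted_ne_zero_of_le q hn (show m ≤ s + m by omega)
    rw [eq_div_iff (by simp [*]), add_comm m p, qShifted_add]
    have e1 : a * q / (x * y) * q ^ p = b * z * q ^ s / a := by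
      rw [div_mul_eq_mul_div, div_eq_div_iff (by simp [*]) ha]
      linear_combination -h
    have e2 : a * q ^ (2 * m) * q / (x * q ^ m * (y * q ^ m)) = a * q / (x * y) := by
      field_simp; ring
    have e3 : q / (b * z * q ^ s / a * q ^ m) = a * q / (b * z * q ^ (s + m)) := by
      field_simp; ring
    rw [e1, e2, qShifted_inversion hq (x := b * z * q ^ s / a) (by simp [*]), e3]
  -- `(aq/(cde q^m))_{p+2m}` is split as `p + 2m` and as `m + (m + p)`; the last `2m` factors of one
  -- splitting and the first `m` of the other are reversed.
  have rY : qShifted q (a * q ^ (2 * m) * q / (c * q ^ m * (d * q ^ m) * (e * q ^ m))) p *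
      ((b * q ^ s / (a * q ^ m)) ^ (2 * m) * q ^ (4 * m.choose 2 + m) *
        qShifted q (a * q / (b * q ^ (s + m))) (2 * m)) =
      (-(a * q / (c * d * e * q ^ m))) ^ m * q ^ m.choose 2 *
        qShifted q (a * q ^ (m + p + 1) / (b * q ^ (s + m))) m *
        qShifted q (a * q / (c * d * e)) (m + p) := by
    have e1 : a * q / (c * d * e * q ^ m) * q ^ p = b * q ^ s / (a * q ^ m) := by
      rw [div_mul_eq_mul_div, div_eq_div_iff (by simp [*]) (by simp [*])]
      linear_combination (-q ^ m) * hbal'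
    have e2 : q / (b * q ^ s / (a * q ^ m) * q ^ (2 * m)) = a * q / (b * q ^ (s + m)) := by
      field_simp; ring
    have e3 : q / (a * q / (c * d * e * q ^ m) * q ^ m) =
        a * q ^ (m + p + 1) / (b * q ^ (s + m)) := by
      rw [div_mul_eq_mul_div, div_div_eq_mul_div, div_eq_div_iff (by simp [*]) (by simp [*])]
      linear_combination (q * q ^ (2 * m)) * hbal'
    have i1 := qShifted_inversion hq (x := b * q ^ s / (a * q ^ m)) (by simp [*]) (2 * m)
    have i2 := qShifted_inversion hq (x := a * q / (c * d * e * q ^ m)) (by simp [*]) m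
    rw [e2, (even_two_mul m).neg_pow, choose_two_mul_two, ← e1] at i1
    rw [e3] at i2
    rw [hY0, ← e1, ← i1, ← i2, ← qShifted_add, show p + 2 * m = m + (m + p) by ring, qShifted_add]
    congr 2
    field_simp
  have hΔ := qShifted_ne_zero_of_le q hBN (show m ≤ s + m by omega)
  -- The monomials created by the reversals agree: apart from `q ^ (4 * m.choose 2)`, each side is
  -- the `m`-th power of the same scalar.
  have hκ : q ^ m * ((b * q ^ s / (a * q ^ m)) ^ (2 * m) * q ^ (4 * m.choose 2 + m)) =
      (q / (b * q ^ (s + m))) ^ m * ((-(b * e * q ^ s / a)) ^ m * q ^ m.choose 2) *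
      ((-(b * d * q ^ s / a)) ^ m * q ^ m.choose 2) *
      ((-(b * c * q ^ s / a)) ^ m * q ^ m.choose 2) *
      ((-(a * q / (c * d * e * q ^ m))) ^ m * q ^ m.choose 2) := by
    calc _ = (q * (b * q ^ s / (a * q ^ m)) ^ 2 * q) ^ m * q ^ (4 * m.choose 2) := by
          rw [mul_pow, mul_pow, ← pow_mul, pow_add]; ring
      _ = (q / (b * q ^ (s + m)) * (-(b * e * q ^ s / a)) * (-(b * d * q ^ s / a)) *
          (-(b * c * q ^ s / a)) * (-(a * q / (c * d * e * q ^ m)))) ^ m *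
          q ^ (4 * m.choose 2) := by
        congr 2
        field_simp
        ring
      _ = _ := by
        simp only [mul_pow, pow_mul']; ring
  have hK : q ^ m / (qShifted q (a * q / (b * q ^ (s + m))) (2 * m) *
      ((-(b * e * q ^ s / a)) ^ m * q ^ m.choose 2) *
      ((-(b * d * q ^ s / a)) ^ m * q ^ m.choose 2) *
      ((-(b * c * q ^ s / a)) ^ m * q ^ m.choose 2) *
      qShifted q (a * q ^ (2 * m) * q / (c * q ^ m * (d * q ^ m) * (e * q ^ m))) p) =
      (q / (b * q ^ (s + m))) ^ m / (qShifted q (a * q ^ (m + p + 1) / (b * q ^ (s + m))) m *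
        qShifted q (a * q / (c * d * e)) (m + p)) := by
    have hκ5 : (-(a * q / (c * d * e * q ^ m))) ^ m * q ^ m.choose 2 ≠ 0 := by simp [*]
    rw [div_eq_div_iff (by simp [hb, hc, hd, he, ha, hq, hγ2, hZ']) (mul_ne_zero hΔ hZ)]
    refine mul_left_cancel₀ hκ5 ?_
    linear_combination (-q ^ m) * rY + (qShifted q (a * q / (b * q ^ (s + m))) (2 * m) *
      qShifted q (a * q ^ (2 * m) * q / (c * q ^ m * (d * q ^ m) * (e * q ^ m))) p) * hκ
  rw [sum_congr rfl hterm, ← mul_sum, hJ, rP c d e hc hd he hbal' hBE,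
    rP c e d hc he hd (by linear_combination hbal') hBD,
    rP d e c hd he hc (by linear_combination hbal') hBC, hx c hc, hx d hd, hx e he, rβ, ← rA]
  generalize qShifted q (a * q / (b * q ^ (s + m))) (2 * m) = Γ at *
  generalize (-(b * e * q ^ s / a)) ^ m * q ^ m.choose 2 = κ1 at *
  generalize (-(b * d * q ^ s / a)) ^ m * q ^ m.choose 2 = κ2 at *
  generalize (-(b * c * q ^ s / a)) ^ m * q ^ m.choose 2 = κ3 at *
  generalize (q / (b * q ^ (s + m))) ^ m = K at *
  generalize qShifted q (a * q ^ (2 * m) * q / (c * q ^ m * (d * q ^ m) * (e * q ^ m))) p = Y at *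
  generalize qShifted q (a * q ^ (m + p + 1) / (b * q ^ (s + m))) m = Δ at *
  generalize qShifted q (a * q / (c * d * e)) (m + p) = Z at *
  generalize qShifted q (a * q / (c * d)) (m + p) = P1 at *
  generalize qShifted q (a * q / (c * e)) (m + p) = P2 at *
  generalize qShifted q (a * q / (d * e)) (m + p) = P3 at *
  generalize 1 - a = A1 at *
  generalize 1 - a * q ^ (2 * m) = A2 at *
  generalize qShifted q (a * q / c) m = C1 at *
  generalize qShifted q (a * q / d) m = C2 at *
  generalize qShifted q (a * q / e) m = C3 at *
  generalize qShifted q (a * q ^ (2 * m) * q / (c * q ^ m)) p = D1 at *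
  generalize qShifted q (a * q ^ (2 * m) * q / (d * q ^ m)) p = D2 at *
  generalize qShifted q (a * q ^ (2 * m) * q / (e * q ^ m)) p = D3 at *
  generalize qShifted q (a * q / (b * c * q ^ (s + m))) m = E1 at *
  generalize qShifted q (a * q / (b * d * q ^ (s + m))) m = E2 at *
  generalize qShifted q (a * q / (b * e * q ^ (s + m))) m = E3 at *
  trans qShifted q b (s + m) * qShifted q (a * q / (b * q ^ (s + m))) (s + m) *
      (qShifted q a (2 * m) * A2 * qShifted q (a * q ^ (2 * m) * q) p /
        (A1 * qShifted q (a * q ^ (1 + (m + p))) m)) *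
      (P1 * P2 * P3) / (C1 * D1 * (C2 * D2) * (C3 * D3)) *
      (qShifted q c m * qShifted q d m * qShifted q e m * qShifted q (q ^ (m + p))⁻¹ m) /
      (E1 * E2 * E3) * (q ^ m / (Γ * κ1 * κ2 * κ3 * Y))
  · ring
  · rw [hK]; ring

/-! ### Removing the genericity of `a` by continuity. -/

@[fun_prop]
theorem ContinuousAt.qShifted {q : ℂ} {f : ℂ → ℂ} {x : ℂ} (hf : ContinuousAt f x) (k : ℕ) :
    ContinuousAt (fun y => qShifted q (f y) k) x := by
  unfold _root_.qShifted
  fun_prop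

theorem eventually_qShifted_ne_zero {q : ℂ} (hq : q ≠ 0) (a : ℂ) (k : ℕ) :
    ∀ᶠ x in 𝓝[≠] a, qShifted q x k ≠ 0 := by
  simp only [qShifted_ne_zero_iff]
  refine (Filter.eventually_all_finite (Set.finite_Iio k)).2 fun j _ => ?_
  have hj : q ^ j ≠ 0 := pow_ne_zero _ hq
  have h : ∀ᶠ x in 𝓝[≠] a, x ≠ (q ^ j)⁻¹ := by
    by_cases hx : a = (q ^ j)⁻¹
    · rw [← hx]; exact self_mem_nhdsWithin
    · exact nhdsWithin_le_nhds (continuousAt_id.eventually_ne hx)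
  filter_upwards [h] with x hx h0
  exact hx (eq_inv_of_mul_eq_one_left (sub_eq_zero.1 h0).symm)

/-- Both sides are continuous in `a` when `e` varies with `a` so as to keep the series balanced.
Near `a`, but away from it, the generic case applies. -/
theorem sum_wellPoisedTerm_mul_shiftFactor {q a b c d e : ℂ} {m s n : ℕ}
    (hq : q ≠ 0) (hq1 : ∀ k, qShifted q q k ≠ 0) (ha : a ≠ 0) (ha1 : a ≠ 1)
    (hb : b ≠ 0) (hc : c ≠ 0) (hd : d ≠ 0) (he : e ≠ 0)
    (hbal : b * c * d * e * q ^ (s + m) = a ^ 2 * q ^ (n + 1))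
    (hX : qShifted q (a * q ^ (1 + n)) n ≠ 0)
    (hB : qShifted q (a * q / (b * q ^ (s + m))) (s + m + n) ≠ 0)
    (hC : qShifted q (a * q / c) n ≠ 0) (hD : qShifted q (a * q / d) n ≠ 0)
    (hE : qShifted q (a * q / e) n ≠ 0)
    (hZ : qShifted q (a * q / (c * d * e)) n ≠ 0)
    (hBC : qShifted q (a * q / (b * c * q ^ (s + m))) (s + m) ≠ 0)
    (hBD : qShifted q (a * q / (b * d * q ^ (s + m))) (s + m) ≠ 0)
    (hBE : qShifted q (a * q / (b * e * q ^ (s + m))) (s + m) ≠ 0)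
    (hBN : qShifted q (a * q ^ (n + 1) / (b * q ^ (s + m))) (s + m) ≠ 0) :
    ∑ k ∈ range (n + 1), wellPoisedTerm q a b c d e n k * shiftFactor q a b m s k =
      qShifted q b (s + m) * qShifted q (a * q / (b * q ^ (s + m))) (s + m) *
        (q / (b * q ^ (s + m))) ^ m *
      ((qShifted q (a * q) n * qShifted q (a * q / (c * d)) n * qShifted q (a * q / (c * e)) n *
        qShifted q (a * q / (d * e)) n) /
      (qShifted q (a * q / c) n * qShifted q (a * q / d) n * qShifted q (a * q / e) n *
        qShifted q (a * q / (c * d * e)) n)) *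
      ((qShifted q c m * qShifted q d m * qShifted q e m * qShifted q (q ^ n)⁻¹ m) /
        (qShifted q (a * q / (b * c * q ^ (s + m))) m *
          qShifted q (a * q / (b * d * q ^ (s + m))) m *
          qShifted q (a * q / (b * e * q ^ (s + m))) m *
          qShifted q (a * q ^ (n + 1) / (b * q ^ (s + m))) m)) := by
  have hsm : q ^ (s + m) ≠ 0 := pow_ne_zero _ hq
  obtain ⟨E, hE0, hEc, hEb⟩ : ∃ E : ℂ → ℂ, E a = e ∧ ContinuousAt E a ∧
      ∀ x, b * c * d * E x * q ^ (s + m) = x ^ 2 * q ^ (n + 1) := by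
    refine ⟨fun x => x ^ 2 * q ^ (n + 1) / (b * c * d * q ^ (s + m)), ?_, by fun_prop, fun x => ?_⟩
    · simp only
      rw [← hbal]; field_simp
    · field_simp
  have hBn : qShifted q (a * q / b) n ≠ 0 := by
    rw [qShifted_add] at hB
    convert right_ne_zero_of_mul hB using 2
    field_simp
  have hsub : 1 - a ≠ 0 := sub_ne_zero.2 (Ne.symm ha1)
  have lhs : ContinuousAt (fun x => ∑ k ∈ range (n + 1),
      wellPoisedTerm q x b c d (E x) n k * shiftFactor q x b m s k) a := by
    refine tendsto_finsetSum _ fun k hk => ?_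
    have hk' : k ≤ n := by rw [mem_range] at hk; omega
    have t1 := qShifted_ne_zero_of_le q hX hk'
    have t2 := qShifted_ne_zero_of_le q hC hk'
    have t3 := qShifted_ne_zero_of_le q hD hk'
    have t4 := qShifted_ne_zero_of_le q hE hk'
    have t5 := qShifted_ne_zero_of_le q hBn hk'
    have t6 := hq1 k
    unfold wellPoisedTerm shiftFactor
    change ContinuousAt _ a
    fun_prop (disch := simp [*])
  have rhs : ContinuousAt (fun a => qShifted q b (s + m) *
      qShifted q (a * q / (b * q ^ (s + m))) (s + m) *
        (q / (b * q ^ (s + m))) ^ m *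
      ((qShifted q (a * q) n * qShifted q (a * q / (c * d)) n * qShifted q (a * q / (c * E a)) n *
        qShifted q (a * q / (d * E a)) n) /
      (qShifted q (a * q / c) n * qShifted q (a * q / d) n * qShifted q (a * q / E a) n *
        qShifted q (a * q / (c * d * E a)) n)) *
      ((qShifted q c m * qShifted q d m * qShifted q (E a) m * qShifted q (q ^ n)⁻¹ m) /
        (qShifted q (a * q / (b * c * q ^ (s + m))) m *
          qShifted q (a * q / (b * d * q ^ (s + m))) m *
          qShifted q (a * q / (b * E a * q ^ (s + m))) m *
          qShifted q (a * q ^ (n + 1) / (b * q ^ (s + m))) m))) a := by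
    have hm : m ≤ s + m := by omega
    have t1 := qShifted_ne_zero_of_le q hBC hm
    have t2 := qShifted_ne_zero_of_le q hBD hm
    have t3 := qShifted_ne_zero_of_le q hBE hm
    have t4 := qShifted_ne_zero_of_le q hBN hm
    fun_prop (disch := simp [*])
  have hev : ∀ {f : ℂ → ℂ}, ContinuousAt f a → f a ≠ 0 → ∀ᶠ x in 𝓝[≠] a, f x ≠ 0 :=
    fun hf h => nhdsWithin_le_nhds (hf.eventually_ne h)
  have key := tendsto_nhds_unique_of_eventuallyEq (l := 𝓝[≠] a) (lhs.mono_left nhdsWithin_le_nhds)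
    (rhs.mono_left nhdsWithin_le_nhds) (by
      subst hE0
      filter_upwards [eventually_qShifted_ne_zero hq a (2 * n + 1),
        hev (f := fun x => x) (by fun_prop) ha, hev hEc he,
        hev (f := fun a => qShifted q (a * q / (b * q ^ (s + m))) (s + m + n)) (by fun_prop) hB,
        hev (f := fun a => qShifted q (a * q / c) n) (by fun_prop) hC,
        hev (f := fun a => qShifted q (a * q / d) n) (by fun_prop) hD,
        hev (f := fun a => qShifted q (a * q / E a) n) (by fun_prop (disch := simp [*])) hE,
        hev (f := fun a => qShifted q (a * q / (c * d * E a)) n)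
          (by fun_prop (disch := simp [*])) hZ,
        hev (f := fun a => qShifted q (a * q / (b * c * q ^ (s + m))) (s + m)) (by fun_prop) hBC,
        hev (f := fun a => qShifted q (a * q / (b * d * q ^ (s + m))) (s + m)) (by fun_prop) hBD,
        hev (f := fun a => qShifted q (a * q / (b * E a * q ^ (s + m))) (s + m))
          (by fun_prop (disch := simp [*])) hBE,
        hev (f := fun a => qShifted q (a * q ^ (n + 1) / (b * q ^ (s + m))) (s + m))
          (by fun_prop) hBN] with x h1 h2 h3 h4 h5 h6 h7 h8 h9 h10 h11 h12
      exact sum_wellPoisedTerm_mul_shiftFactor_of_generic hq hq1 h2 hb hc hd h3 (hEb x) h1 h4 h5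
        h6 h7 h8 h9 h10 h11 h12)
  simpa only [hE0] using key

/-! ### From the multiple sum to a determinant of single sums. -/

theorem shiftFactor_eq_prod {q a b : ℂ} (hq : q ≠ 0) (hb : b ≠ 0) (m s k : ℕ) :
    shiftFactor q a b m s k = q ^ (k * (s + m)) *
      ((∏ l ∈ range s, ((q ^ k)⁻¹ + a * q ^ k - (b * q ^ l + a / (b * q ^ l)))) *
        ∏ l ∈ range m, ((q ^ k)⁻¹ + a * q ^ k - ((q ^ l)⁻¹ + a * q ^ l))) := by
  rw [shiftFactor, ← prod_one_sub_div_pow hq, ← prod_one_sub_div_pow hq, qShifted, qShifted,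
    ← prod_mul_distrib, mul_assoc, ← prod_mul_distrib, pow_mul, pow_add,
    ← card_range s, ← card_range m, ← prod_const, ← prod_const, card_range, card_range,
    mul_mul_mul_comm, ← prod_mul_distrib, ← prod_mul_distrib, mul_comm]
  congr 1 <;>
  · refine prod_congr rfl fun l _ => ?_
    field_simp
    ring

theorem prod_prod_Ioi_mul_eq_prod_pow {R : ℕ} (g : Fin (R + 1) → ℂ) :
    ∏ i, ∏ j ∈ Ioi i, (g i * g j) = ∏ i, g i ^ R := by
  rw [prod_prod_Ioi_mul_eq_prod_prod_off_diag fun _ j => g j]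
  simp [card_compl]

/-- As `s + m = R` in every column, the power `q ^ (k i * R)` leaves row `i` as a common factor.
Each index lies in exactly `R` pairs, so these powers supply one factor `q ^ k i * q ^ k j` per pair
and clear the denominators of the Vandermonde product. -/
theorem det_shiftFactor {q a b : ℂ} (hq : q ≠ 0) (hb : b ≠ 0) {R : ℕ} (k : Fin (R + 1) → ℕ) :
    (Matrix.of fun i j : Fin (R + 1) => shiftFactor q a b (R - j) j (k i)).det =
      (∏ i, ∏ j ∈ Ioi i, ((q ^ k i - q ^ k j) * (1 - a * q ^ (k i + k j)))) *
        ∏ j : Fin (R + 1), ∏ l ∈ range (R - (j : ℕ)),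
          (b * q ^ (j : ℕ) + a / (b * q ^ (j : ℕ)) - ((q ^ l)⁻¹ + a * q ^ l)) := by
  have h := det_prod_sub_mul_prod_sub (r := R + 1) (fun i => (q ^ k i)⁻¹ + a * q ^ k i)
    (fun l => b * q ^ l + a / (b * q ^ l)) (fun l => (q ^ l)⁻¹ + a * q ^ l)
  rw [Nat.add_sub_cancel] at h
  have h2 : (Matrix.of fun i j : Fin (R + 1) => shiftFactor q a b (R - j) j (k i)) =
      Matrix.of fun i j => q ^ (k i * R) *
        ((Matrix.of fun i j : Fin (R + 1) =>
          (∏ l ∈ range (j : ℕ), ((q ^ k i)⁻¹ + a * q ^ k i - (b * q ^ l + a / (b * q ^ l)))) *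
          ∏ l ∈ range (R - (j : ℕ)), ((q ^ k i)⁻¹ + a * q ^ k i - ((q ^ l)⁻¹ + a * q ^ l))) i j) := by
    ext i j
    rw [Matrix.of_apply, Matrix.of_apply, Matrix.of_apply, shiftFactor_eq_prod hq hb,
      show (j : ℕ) + (R - j) = R by omega]
  rw [h2, Matrix.det_mul_column, h, ← mul_assoc]
  congr 1
  have h3 := prod_prod_Ioi_mul_eq_prod_pow fun i => q ^ k i
  simp_rw [pow_mul]
  rw [← h3, ← prod_mul_distrib]
  refine prod_congr rfl fun i _ => ?_
  rw [← prod_mul_distrib]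
  refine prod_congr rfl fun j _ => ?_
  field_simp
  ring

/-- In the Leibniz expansion each permutation contributes a product of functions of one index each,
so its sum over the box factors. -/
theorem sum_piFinset_prod_mul_det {r : ℕ} (w : Fin r → ℕ → ℂ) (f : Fin r → ℕ → ℂ)
    (t : Fin r → Finset ℕ) :
    ∑ k ∈ Fintype.piFinset t, (∏ i, w i (k i)) * (Matrix.of fun i j => f j (k i)).det =
      (Matrix.of fun i j => ∑ k ∈ t i, w i k * f j k).det := by
  rw [← Matrix.det_transpose, Matrix.det_apply']
  simp_rw [← Matrix.det_transpose (Matrix.of fun i j => f j _), Matrix.det_apply', mul_sum]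
  rw [sum_comm]
  refine sum_congr rfl fun σ _ => ?_
  simp only [Matrix.transpose_apply, Matrix.of_apply]
  rw [prod_univ_sum, mul_sum]
  refine sum_congr rfl fun k _ => ?_
  rw [prod_mul_distrib]
  ring

theorem sum_range_choose_two (R : ℕ) : ∑ j ∈ range (R + 1), (R - j).choose 2 = (R + 1).choose 3 := by
  rw [← sum_range_reflect]
  induction R with
  | zero => rfl
  | succ R ih =>
    rw [sum_range_succ, Nat.choose_succ_succ' (R + 1) 2, ← ih, add_comm]
    congr 1
    · simp
    · refine sum_congr rfl fun j hj => ?_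
      rw [mem_range] at hj
      congr 1; omega

theorem sum_range_sub_eq_choose (R : ℕ) : ∑ j ∈ range (R + 1), (R - j) = (R + 1).choose 2 := by
  rw [← sum_range_reflect]
  simp only [Nat.add_sub_cancel]
  rw [sum_congr rfl (g := fun j => j) fun j hj => by rw [mem_range] at hj; omega,
    sum_range_id, Nat.choose_two_right]

/-- Evaluates the constant `K` through `u_j - w_l = -q⁻ˡ (1 - b q^(j+l)) (1 - a qˡ / (b qʲ))`.
Multiplying by the `(b)_j` completes the first family of factors to `(b)_R` in each column. -/
theorem prod_prod_node_sub_node {q a b : ℂ} (hq : q ≠ 0) (hb : b ≠ 0) (R : ℕ) :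
    (∏ j : Fin (R + 1), ∏ l ∈ range (R - (j : ℕ)),
      (b * q ^ (j : ℕ) + a / (b * q ^ (j : ℕ)) - ((q ^ l)⁻¹ + a * q ^ l))) *
      ∏ j : Fin (R + 1), qShifted q b j =
    (-1) ^ (R + 1).choose 2 / q ^ (R + 1).choose 3 * qShifted q b R ^ (R + 1) *
      ∏ j : Fin (R + 1), qShifted q (a * q ^ (R + 1) / (q ^ (j : ℕ) * q ^ (j : ℕ)) / b) j := by
  have h1 (j : ℕ) : ∏ l ∈ range (R - j),
      (b * q ^ j + a / (b * q ^ j) - ((q ^ l)⁻¹ + a * q ^ l)) =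
      (-1) ^ (R - j) / q ^ (R - j).choose 2 * qShifted q (b * q ^ j) (R - j) *
        ∏ l ∈ range (R - j), (1 - a * q ^ l / b / q ^ j) := by
    rw [qShifted, show (R - j).choose 2 = ∑ l ∈ range (R - j), l by rw [sum_range_id, Nat.choose_two_right], ← prod_pow_eq_pow_sum,
      ← card_range (R - j), ← prod_const, card_range, ← prod_div_distrib, ← prod_mul_distrib,
      ← prod_mul_distrib]
    refine prod_congr rfl fun l _ => ?_
    field_simp
    ring
  -- Exchanging the two indices of the triangle gathers the factors with a fixed `l`; reflecting `l
  -- = R - j` gives the form of the statement.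
  have h2 : ∏ j ∈ range (R + 1), ∏ l ∈ range (R - j), (1 - a * q ^ l / b / q ^ j) =
      ∏ j ∈ range (R + 1), qShifted q (a * q ^ (R + 1) / (q ^ j * q ^ j) / b) j := by
    rw [prod_comm' (t' := range (R + 1)) (s' := fun l => range (R - l))
      (by intro x y; simp only [mem_range]; omega), ← prod_range_reflect]
    refine prod_congr rfl fun j hj => ?_
    rw [mem_range] at hj
    obtain ⟨t, rfl⟩ : ∃ t, R = t + j := ⟨R - j, by omega⟩
    rw [prod_one_sub_div_pow hq, show t + j + 1 - 1 - j = t by omega,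
      show t + j - t = j by omega]
    congr 1
    field_simp
    ring
  rw [Fin.prod_univ_eq_prod_range (fun j => ∏ l ∈ range (R - j),
      (b * q ^ j + a / (b * q ^ j) - ((q ^ l)⁻¹ + a * q ^ l))) (R + 1),
    Fin.prod_univ_eq_prod_range (fun j => qShifted q b j) (R + 1),
    Fin.prod_univ_eq_prod_range
      (fun j => qShifted q (a * q ^ (R + 1) / (q ^ j * q ^ j) / b) j) (R + 1), ← h2]
  simp_rw [h1]
  rw [prod_mul_distrib, mul_right_comm, prod_mul_distrib, prod_div_distrib, prod_pow_eq_pow_sum,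
    prod_pow_eq_pow_sum, sum_range_choose_two, sum_range_sub_eq_choose,
    mul_assoc _ (∏ j ∈ range (R + 1), qShifted q (b * q ^ j) (R - j)),
    ← prod_mul_distrib]
  congr 2
  rw [← card_range (R + 1), ← prod_const, card_range]
  refine prod_congr rfl fun j hj => ?_
  rw [mem_range] at hj
  rw [mul_comm (qShifted q (b * q ^ j) (R - j)), ← qShifted_add]
  congr 1; omega

/-! ### Evaluation of the multiple sum. -/

/-- The product side of Jackson's sum. -/
noncomputable def jacksonProduct (q a c d e : ℂ) (n : ℕ) : ℂ :=
  (qShifted q (a * q) n * qShifted q (a * q / (c * d)) n * qShifted q (a * q / (c * e)) n *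
    qShifted q (a * q / (d * e)) n) /
  (qShifted q (a * q / c) n * qShifted q (a * q / d) n * qShifted q (a * q / e) n *
    qShifted q (a * q / (c * d * e)) n)

/-- If some `k i ≥ R`, then `(b)_{k i} = 0`. Otherwise `R + 1` indices take values below `R`, two of
them coincide, and the Vandermonde product vanishes. -/
theorem sum_wellPoisedTerm_vandermonde_eq_zero {q a b : ℂ} {R : ℕ} (c d e : Fin (R + 1) → ℂ)
    (n : Fin (R + 1) → ℕ) (hbR : qShifted q b R = 0) :
    ∑ k ∈ Fintype.piFinset (fun i => range (n i + 1)),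
      (∏ i, ∏ j ∈ Ioi i, ((q ^ k i - q ^ k j) * (1 - a * q ^ (k i + k j)))) *
        ∏ i, wellPoisedTerm q a b (c i) (d i) (e i) (n i) (k i) = 0 := by
  refine sum_eq_zero fun k _ => ?_
  by_cases hk : ∃ i, R ≤ k i
  · obtain ⟨i, hi⟩ := hk
    have : qShifted q b (k i) = 0 := by
      by_contra h
      exact qShifted_ne_zero_of_le q h hi hbR
    refine mul_eq_zero_of_right _ (prod_eq_zero (mem_univ i) ?_)
    simp [wellPoisedTerm, this]
  · push Not at hk
    obtain ⟨i, j, hij, h⟩ := Fintype.exists_ne_map_eq_of_card_lt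
      (fun i => (⟨k i, hk i⟩ : Fin R)) (by simp)
    simp only [Fin.mk.injEq] at h
    refine mul_eq_zero_of_left ?_ _
    rcases lt_or_gt_of_ne hij with hlt | hlt
    · exact prod_eq_zero (mem_univ i) (prod_eq_zero (mem_Ioi.2 hlt) (by rw [h]; ring))
    · exact prod_eq_zero (mem_univ j) (prod_eq_zero (mem_Ioi.2 hlt) (by rw [h]; ring))

theorem sum_wellPoisedTerm_vandermonde {q a b : ℂ} {R : ℕ} {c d e : Fin (R + 1) → ℂ}
    {n : Fin (R + 1) → ℕ}
    (hq : q ≠ 0) (hq1 : ∀ k, qShifted q q k ≠ 0) (ha : a ≠ 0) (ha1 : a ≠ 1)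
    (hb : b ≠ 0) (hc : ∀ i, c i ≠ 0) (hd : ∀ i, d i ≠ 0) (he : ∀ i, e i ≠ 0)
    (hbal : ∀ i, b * c i * d i * e i * q ^ R = a ^ 2 * q ^ (n i + 1))
    (hX : ∀ i, qShifted q (a * q ^ (1 + n i)) (n i) ≠ 0)
    (hB : ∀ i, qShifted q (a * q / b) (n i) ≠ 0)
    (hC : ∀ i, qShifted q (a * q / c i) (n i) ≠ 0)
    (hD : ∀ i, qShifted q (a * q / d i) (n i) ≠ 0)
    (hE : ∀ i, qShifted q (a * q / e i) (n i) ≠ 0)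
    (hZ : ∀ i, qShifted q (a * q / (c i * d i * e i)) (n i) ≠ 0)
    (hG : ∀ i : Fin (R + 1),
      qShifted q (a * q ^ (R + 1) / (q ^ (i : ℕ) * q ^ (i : ℕ)) / b) i ≠ 0)
    (hBC : ∀ i, qShifted q (a * q / (b * c i * q ^ R)) R ≠ 0)
    (hBD : ∀ i, qShifted q (a * q / (b * d i * q ^ R)) R ≠ 0)
    (hBE : ∀ i, qShifted q (a * q / (b * e i * q ^ R)) R ≠ 0)
    (hBN : ∀ i, qShifted q (a * q ^ (n i + 1) / (b * q ^ R)) R ≠ 0) :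
    ∑ k ∈ Fintype.piFinset (fun i => range (n i + 1)),
      (∏ i, ∏ j ∈ Ioi i, ((q ^ k i - q ^ k j) * (1 - a * q ^ (k i + k j)))) *
        ∏ i, wellPoisedTerm q a b (c i) (d i) (e i) (n i) (k i) =
      ((-b) ^ (R + 1).choose 2)⁻¹ * (q ^ (2 * (R + 1).choose 3))⁻¹ *
      (∏ i : Fin (R + 1), (qShifted q (a * q / (b * q ^ R)) R * qShifted q b i /
        qShifted q (a * q ^ (R + 1) / (q ^ (i : ℕ) * q ^ (i : ℕ)) / b) i *
        jacksonProduct q a (c i) (d i) (e i) (n i))) *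
      (Matrix.of fun i j : Fin (R + 1) =>
        (qShifted q (c i) (R - j) * qShifted q (d i) (R - j) * qShifted q (e i) (R - j) *
          qShifted q (q ^ n i)⁻¹ (R - j)) /
        (qShifted q (a * q / (b * c i * q ^ R)) (R - j) *
          qShifted q (a * q / (b * d i * q ^ R)) (R - j) *
          qShifted q (a * q / (b * e i * q ^ R)) (R - j) *
          qShifted q (a * q ^ (n i + 1) / (b * q ^ R)) (R - j))).det := by
  -- If `(b)_R = 0`, the last factor of the product on the right vanishes too. If not, `K ≠ 0`, and
  -- the identity may be proved after multiplication by `K`.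
  by_cases hbR : qShifted q b R = 0
  · rw [sum_wellPoisedTerm_vandermonde_eq_zero c d e n hbR, prod_eq_zero (mem_univ (Fin.last R)),
      mul_zero, zero_mul]
    simp [hbR]
  have hK := prod_prod_node_sub_node (a := a) hq hb R
  set K := ∏ j : Fin (R + 1), ∏ l ∈ range (R - (j : ℕ)),
      (b * q ^ (j : ℕ) + a / (b * q ^ (j : ℕ)) - ((q ^ l)⁻¹ + a * q ^ l))
  have hG' := prod_ne_zero_iff.2 fun i (_ : i ∈ univ) => hG i
  have hb' : ∏ j : Fin (R + 1), qShifted q b j ≠ 0 := prod_ne_zero_iff.2 fun i _ =>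
    qShifted_ne_zero_of_le q hbR (by omega)
  have hK0 : K ≠ 0 := by
    intro h
    rw [h, zero_mul] at hK
    exact mul_ne_zero (mul_ne_zero (div_ne_zero (by simp) (pow_ne_zero _ hq))
      (pow_ne_zero _ hbR)) hG' hK.symm
  refine mul_right_cancel₀ hK0 ?_
  rw [sum_mul]
  -- This is `hG` at the last index `i = R`, where `q ^ (R + 1) / q ^ (2 * R) = q / q ^ R`.
  have hγ : qShifted q (a * q / (b * q ^ R)) R ≠ 0 := by
    have h := hG (Fin.last R)
    rw [Fin.val_last] at h
    convert h using 2
    field_simp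
    ring
  have hBR (i) : qShifted q (a * q / (b * q ^ R)) (R + n i) ≠ 0 := by
    rw [qShifted_add]
    refine mul_ne_zero hγ ?_
    convert hB i using 2
    field_simp
  calc _ = ∑ k ∈ Fintype.piFinset (fun i => range (n i + 1)),
        (∏ i, wellPoisedTerm q a b (c i) (d i) (e i) (n i) (k i)) *
          (Matrix.of fun i j : Fin (R + 1) => shiftFactor q a b (R - j) j (k i)).det := by
        refine sum_congr rfl fun k _ => ?_
        rw [det_shiftFactor hq hb]
        ring
    _ = (Matrix.of fun i j : Fin (R + 1) => ∑ k ∈ range (n i + 1),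
          wellPoisedTerm q a b (c i) (d i) (e i) (n i) k *
            shiftFactor q a b (R - j) j k).det :=
        sum_piFinset_prod_mul_det (fun i => wellPoisedTerm q a b (c i) (d i) (e i) (n i))
          (fun j : Fin (R + 1) => shiftFactor q a b (R - j) j) _
    _ = (∏ i, jacksonProduct q a (c i) (d i) (e i) (n i)) *
      ((∏ j : Fin (R + 1), (qShifted q b R * qShifted q (a * q / (b * q ^ R)) R *
        (q / (b * q ^ R)) ^ (R - (j : ℕ)))) *
      (Matrix.of fun i j : Fin (R + 1) =>
        (qShifted q (c i) (R - j) * qShifted q (d i) (R - j) * qShifted q (e i) (R - j) *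
          qShifted q (q ^ n i)⁻¹ (R - j)) /
        (qShifted q (a * q / (b * c i * q ^ R)) (R - j) *
          qShifted q (a * q / (b * d i * q ^ R)) (R - j) *
          qShifted q (a * q / (b * e i * q ^ R)) (R - j) *
          qShifted q (a * q ^ (n i + 1) / (b * q ^ R)) (R - j))).det) := by
        rw [← Matrix.det_mul_row, ← Matrix.det_mul_column]
        congr 1
        ext i j
        have hR : (j : ℕ) + (R - j) = R := by omega
        have h := sum_wellPoisedTerm_mul_shiftFactor (m := R - j) (s := j) (n := n i) (q := q)
          (a := a) (b := b) (c := c i) (d := d i) (e := e i)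
        rw [hR] at h
        simp only [Matrix.of_apply]
        rw [h hq hq1 ha ha1 hb (hc i) (hd i) (he i) (hbal i) (hX i) (hBR i) (hC i) (hD i) (hE i)
          (hZ i) (hBC i) (hBD i) (hBE i) (hBN i)]
        rw [jacksonProduct]
        ring
    _ = _ := ?_
  rw [← mul_assoc, mul_right_comm _ _ K]
  congr 1
  simp only [prod_mul_distrib, prod_div_distrib]
  rw [prod_pow_eq_pow_sum,
    Fin.sum_univ_eq_sum_range (fun j => R - j) (R + 1), sum_range_sub_eq_choose]
  simp only [prod_const, card_univ, Fintype.card_fin]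
  -- The column factors contribute `q` to the power `-3 * (R + 1).choose 3`; one third of it matches
  -- the power of `q` in `K`, and the other two thirds remain in the prefactor.
  have hch : 3 * (R + 1).choose 3 + (R + 1).choose 2 = R * (R + 1).choose 2 := by
    have h := Nat.choose_succ_right_eq (R + 1) 2
    rcases R with _ | R
    · rfl
    · rw [show R + 1 + 1 - 2 = R by omega] at h
      linear_combination h
  have hpow : (q / (b * q ^ R)) ^ (R + 1).choose 2 =
      ((-b) ^ (R + 1).choose 2)⁻¹ * (q ^ (2 * (R + 1).choose 3))⁻¹ *
      ((-1) ^ (R + 1).choose 2 / q ^ (R + 1).choose 3) := by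
    have h1 : ((-1 : ℂ)) ^ (R + 1).choose 2 * (-1) ^ (R + 1).choose 2 = 1 := by
      rw [← mul_pow]; simp
    rw [div_pow, mul_pow, ← pow_mul, ← hch, neg_pow b]
    have := pow_ne_zero ((R + 1).choose 2) hb
    have h2 : ((-1 : ℂ)) ^ (R + 1).choose 2 ≠ 0 := by simp
    field_simp
    ring
  rw [hpow]
  have hK' : K = (-1) ^ (R + 1).choose 2 / q ^ (R + 1).choose 3 * qShifted q b R ^ (R + 1) *
      (∏ j : Fin (R + 1), qShifted q (a * q ^ (R + 1) / (q ^ (j : ℕ) * q ^ (j : ℕ)) / b) j) /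
      ∏ j : Fin (R + 1), qShifted q b j := by
    rw [eq_div_iff hb', hK]
  rw [hK']
  generalize (∏ j : Fin (R + 1), qShifted q b j) = B at *
  generalize (∏ j : Fin (R + 1),
    qShifted q (a * q ^ (R + 1) / (q ^ (j : ℕ) * q ^ (j : ℕ)) / b) j) = G at *
  generalize (-1 : ℂ) ^ (R + 1).choose 2 / q ^ (R + 1).choose 3 = κ
  field_simp

end

/- The indices `i, j : Fin r` run from `0` to `r - 1`, so the one-based index `i` of the usual
notation is `i + 1` here. The hypotheses from `ha1` on say that no denominator vanishes. -/
theorem corollary7p3 (r : ℕ) (q a b : ℂ) (c d e : Fin r → ℂ) (n : Fin r → ℕ)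
    (hq0 : 0 < ‖q‖) (hq1 : ‖q‖ < 1) (ha0 : a ≠ 0)
    (hbal : ∀ i, b * c i * d i * e i = a ^ 2 * q ^ ((2 : ℤ) - r + n i))
    (ha1 : a ≠ 1)
    (hsum : ∀ i, qShiftedList q [a * q / b, a * q / c i, a * q / d i, a * q / e i,
      a * q ^ (1 + n i)] (n i) ≠ 0)
    (hcde : ∀ i, qShifted q (a * q / (c i * d i * e i)) (n i) ≠ 0)
    (hb : ∀ i : Fin r, qShifted q
      (a * q ^ ((2 : ℤ) + r - 2 * ((i : ℤ) + 1)) / b) (i : ℕ) ≠ 0)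
    (hdet : ∀ i, qShiftedList q [a * q ^ ((2 : ℤ) - r) / (b * c i),
      a * q ^ ((2 : ℤ) - r) / (b * d i), a * q ^ ((2 : ℤ) - r) / (b * e i),
      a * q ^ ((2 : ℤ) - r + n i) / b] (r - 1) ≠ 0) :
    (∑ k ∈ Fintype.piFinset (fun i : Fin r => Finset.range (n i + 1)),
        (∏ i : Fin r, ∏ j ∈ Finset.Ioi i,
          ((q ^ k i - q ^ k j) * (1 - a * q ^ (k i + k j)))) *
        ∏ i : Fin r,
          ((1 - a * q ^ (2 * k i)) *
              qShiftedList q [a, b, c i, d i, e i, q ^ (-(n i : ℤ))] (k i) /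
            ((1 - a) *
              qShiftedList q [q, a * q / b, a * q / c i, a * q / d i, a * q / e i,
                a * q ^ (1 + n i)] (k i)) *
            q ^ k i))
      = (-b) ^ (-(r.choose 2 : ℤ)) * q ^ (-2 * (r.choose 3 : ℤ)) *
        (∏ i : Fin r,
          (qShifted q (a * q ^ ((2 : ℤ) - r) / b) (r - 1) * qShifted q b (i : ℕ) /
              qShifted q (a * q ^ ((2 : ℤ) + r - 2 * ((i : ℤ) + 1)) / b) (i : ℕ) *
            (qShiftedList q [a * q, a * q / (c i * d i), a * q / (c i * e i),
                a * q / (d i * e i)] (n i) /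
              qShiftedList q [a * q / c i, a * q / d i, a * q / e i,
                a * q / (c i * d i * e i)] (n i)))) *
        Matrix.det (Matrix.of fun i j : Fin r =>
          qShiftedList q [c i, d i, e i, q ^ (-(n i : ℤ))] (r - ((j : ℕ) + 1)) /
            qShiftedList q [a * q ^ ((2 : ℤ) - r) / (b * c i),
              a * q ^ ((2 : ℤ) - r) / (b * d i), a * q ^ ((2 : ℤ) - r) / (b * e i),
              a * q ^ ((2 : ℤ) - r + n i) / b] (r - ((j : ℕ) + 1))) := by
  -- For `r = 0` both sides equal `1`. For `r = R + 1` an index exists, so the balancing condition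
  -- forces `b ≠ 0`.
  rcases r with _ | R
  · simp
  have hq : q ≠ 0 := norm_pos_iff.1 hq0
  -- A zero factor would give `q ^ (j + 1) = 1`, impossible for `‖q‖ < 1`.
  have hqk : ∀ k, qShifted q q k ≠ 0 := by
    intro k
    rw [qShifted_ne_zero_iff]
    intro j _ h
    have h1 : ‖q ^ (j + 1)‖ < 1 := by
      rw [norm_pow]; exact pow_lt_one₀ (norm_nonneg _) hq1 (by omega)
    rw [pow_succ', ← sub_eq_zero.1 h, norm_one] at h1
    exact lt_irrefl _ h1
  have z1 : q ^ ((2 : ℤ) - ((R + 1 : ℕ) : ℤ)) = q / q ^ R := by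
    rw [show (2 : ℤ) - ((R + 1 : ℕ) : ℤ) = 1 - (R : ℤ) by push_cast; ring, zpow_sub₀ hq,
      zpow_one, zpow_natCast]
  have z2 (m : ℕ) : q ^ ((2 : ℤ) - ((R + 1 : ℕ) : ℤ) + m) = q ^ (m + 1) / q ^ R := by
    rw [zpow_add₀ hq, z1, zpow_natCast]; ring
  have z3 (m : ℕ) : q ^ (-(m : ℤ)) = (q ^ m)⁻¹ := by rw [zpow_neg, zpow_natCast]
  have z4 (m : ℕ) : q ^ ((2 : ℤ) + ((R + 1 : ℕ) : ℤ) - 2 * ((m : ℤ) + 1)) =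
      q ^ (R + 1) / (q ^ m * q ^ m) := by
    rw [show (2 : ℤ) + ((R + 1 : ℕ) : ℤ) - 2 * ((m : ℤ) + 1) = ((R + 1 : ℕ) : ℤ) - (m + m : ℕ) by
      push_cast; ring, zpow_sub₀ hq, zpow_natCast, zpow_natCast, pow_add q m m]
  have z5 (x : ℂ) : a * (q / q ^ R) / x = a * q / (x * q ^ R) := by
    rw [mul_div_assoc', div_div, mul_comm x]
  have z6 (m : ℕ) : a * (q ^ (m + 1) / q ^ R) / b = a * q ^ (m + 1) / (b * q ^ R) := by
    rw [mul_div_assoc', div_div, mul_comm b]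
  have z7 (m : ℕ) : a * (q ^ (R + 1) / (q ^ m * q ^ m)) / b =
      a * q ^ (R + 1) / (q ^ m * q ^ m) / b := by
    rw [mul_div_assoc']
  have z8 : (-b) ^ (-((R + 1).choose 2 : ℤ)) = ((-b) ^ (R + 1).choose 2)⁻¹ := by
    rw [zpow_neg, zpow_natCast]
  have z9 : q ^ (-2 * ((R + 1).choose 3 : ℤ)) = (q ^ (2 * (R + 1).choose 3))⁻¹ := by
    rw [show -2 * ((R + 1).choose 3 : ℤ) = -((2 * (R + 1).choose 3 : ℕ) : ℤ) by push_cast; ring,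
      zpow_neg, zpow_natCast]
  simp only [z1, z2, z3, z4, z5, z6, z7, z8, z9, qShiftedList, List.map_cons, List.map_nil,
    List.prod_cons, List.prod_nil, mul_one, ne_eq, mul_eq_zero, not_or, Nat.add_sub_cancel,
    Nat.add_sub_add_right, ← mul_assoc] at hbal hsum hb hdet ⊢
  have hbcde (i) : b * c i * d i * e i ≠ 0 := by
    rw [hbal i]; simp [hq, ha0]
  have hb0 : b ≠ 0 := fun h => hbcde 0 (by rw [h]; ring)
  have hc0 (i) : c i ≠ 0 := fun h => hbcde i (by rw [h]; ring)
  have hd0 (i) : d i ≠ 0 := fun h => hbcde i (by rw [h]; ring)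
  have he0 (i) : e i ≠ 0 := fun h => hbcde i (by rw [h]; ring)
  have h := sum_wellPoisedTerm_vandermonde hq hqk ha0 ha1 hb0 hc0 hd0 he0
    (fun i => by rw [hbal i]; field_simp) (fun i => (hsum i).2) (fun i => (hsum i).1.1.1.1)
    (fun i => (hsum i).1.1.1.2) (fun i => (hsum i).1.1.2) (fun i => (hsum i).1.2) hcde hb
    (fun i => (hdet i).1.1.1) (fun i => (hdet i).1.1.2) (fun i => (hdet i).1.2)
    (fun i => (hdet i).2)
  simpa only [wellPoisedTerm, jacksonProduct, ← mul_assoc] using h
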